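/- **Notation.** Let $n\ge 1$, $d\in\mathbb R$, and write $x=(x',x_n)$, $\xi=(\xi',\xi_n)\in\mathbb R^{n-1}\times\mathbb R$, $\langle\xi\rangle=(1+|\xi|^2)^{1/2}$, $\langle\xi'\rangle=(1+|\xi'|^2)^{1/2}$, $D^\alpha=(-i)^{|\alpha|}\partial^\alpha$. For $k\ge0$ and $r\in\mathbb R$, $S^r_{1,0}(\mathbb R^k\times\mathbb R^k)$ is the set of $q\in C^\infty(\mathbb R^{k}\times\mathbb R^k;\mathbb C)$ such that $\sup_{x,\xi\in\mathbb R^k}\langle\xi\rangle^{-(r-|\alpha|)}|D_x^\beta D_\xi^\alpha q(x,\xi)|<\infty$ for all multi-indices $\alpha,\beta\in\mathbb N_0^k$. $\mathcal F^{-1}_{\xi_n\to z_n}$ is the inverse Fourier transformation of tempered distributions on $\mathbb R$ (with $\mathcal F^{-1}f(z)=(2\pi)^{-1}\int e^{iz\xi_n}f(\xi_n)\,d\xi_n$ for integrable $f$), applied in the variable $\xi_n$ for fixed $(x',\xi')$; for $p\in S^d_{1,0}(\mathbb R^n\times\mathbb R^n)$ the distributions $\mathcal F^{-1}_{\xi_n\to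 z_n}D_\xi^\alpha D_x^\beta p(x',0,\xi)$ are $C^\infty$ functions of $z_n$ on $\mathbb R\setminus\{0\}$, and below only their values for $z_n\neq0$ are used. **Proposition.** Let $p\in S^d_{1,0}(\mathbb R^n\times\mathbb R^n)$. The following conditions are equivalent: (i) $p$ satisfies the uniform two-sided transmission condition at $x_n=0$ (that is, $p\in S^d_{1,0,\mathrm{uttr}}(\mathbb R^n\times\mathbb R^n)$): for all $\alpha,\beta\in\mathbb N_0^n$, $l,m\in\mathbb N_0$ and each $\xi'\in\mathbb R^{n-1}$, $$\sup_{x'\in\mathbb R^{n-1},\,z_n\ne0}\bigl|z_n^lD_{z_n}^m\mathcal F^{-1}_{\xi_n\to z_n}D_\xi^\alpha D_x^\beta p(x',0,\xi)\bigr|<\infty.$$ (ii) For all $\alpha,\beta\in\mathbb N_0^n$ there exist $s_{j,\alpha,\beta}(x',\xi')\in S^{d-j-|\alpha|}_{1,0}(\mathbb R^{n-1}\times\mathbb R^{n-1})$, for $j\in\mathbb Z$ with $j\le d-|\alpha|$, such that for every $m\in\mathbb N_0$ $$\Bigl|\xi_n^mD_\xi^\alpha D_x^\beta p(x',0,\xi)-\sum_{-m\le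 j\le d-|\alpha|}s_{j,\alpha,\beta}(x',\xi')\,\xi_n^{j+m}\Bigr|\le C\langle\xi'\rangle^{d+1-|\alpha|+m}\langle\xi\rangle^{-1}$$ with a constant $C$ independent of $(x',\xi)\in\mathbb R^{n-1}\times\mathbb R^n$. (iii) For all $\alpha,\beta\in\mathbb N_0^n$ and $l,m\in\mathbb N_0$, $$\sup_{x',\xi'\in\mathbb R^{n-1},\,z_n\neq0}\langle\xi'\rangle^{-(d+1-|\alpha|-l+m)}\bigl|z_n^lD_{z_n}^m\mathcal F^{-1}_{\xi_n\to z_n}D_\xi^\alpha D_x^\beta p(x',0,\xi)\bigr|<\infty.$$ In the affirmative case, the symbols $s_{j,\alpha,\beta}$ in (ii) are uniquely determined, and they are polynomials in $\xi'\in\mathbb R^{n-1}$ of degree $\le d-j-|\alpha|$ (for each fixed $x'$). -/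

import Mathlib

open scoped ContDiff

noncomputable section

/-- Euclidean space `ℝⁿ` with its Euclidean norm. -/
abbrev Euc (n : ℕ) : Type := EuclideanSpace ℝ (Fin n)

/-- The Japanese bracket `⟨ξ⟩ = (1 + |ξ|²)^{1/2}`. -/
def japBracket {n : ℕ} (ξ : Euc n) : ℝ := Real.sqrt (1 + ‖ξ‖ ^ 2)

/-- The point `(x', t) ∈ ℝ^{k+1}` with `x' ∈ ℝᵏ` and last coordinate `t`. -/
def joinLast {k : ℕ} (x' : Euc k) (t : ℝ) : Euc (k + 1) :=
  WithLp.toLp 2 (Fin.snoc (α := fun _ => ℝ) (fun i => x' i) t)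

/-- The length `|α| = α₁ + ⋯ + αₙ` of a multi-index. -/
def multiLength {n : ℕ} (α : Fin n → ℕ) : ℕ := ∑ i, α i

/-- The directional derivative `∂_v f` of a (differentiable) function. -/
def dirDeriv {V : Type*} [NormedAddCommGroup V] [NormedSpace ℝ V] (v : V) (f : V → ℂ) : V → ℂ :=
  fun y => fderiv ℝ f y v

/-- `D^α f = (-i)^{|α|} ∂_{e₁}^{α₁} ⋯ ∂_{eₙ}^{αₙ} f` for the directions `e₁, …, eₙ`. -/
def multiD {V : Type*} [NormedAddCommGroup V] [NormedSpace ℝ V] {n : ℕ}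
    (e : Fin n → V) (α : Fin n → ℕ) (f : V → ℂ) : V → ℂ :=
  fun y => (-Complex.I) ^ multiLength α *
    (List.finRange n).foldr (fun i g => (dirDeriv (e i))^[α i] g) f y

/-- `D_x^β p`, for a function `p(x, ξ)` on `ℝⁿ × ℝⁿ`. -/
def Dx {n : ℕ} (β : Fin n → ℕ) (p : Euc n × Euc n → ℂ) : Euc n × Euc n → ℂ :=
  multiD (fun i => (EuclideanSpace.single i (1 : ℝ), (0 : Euc n))) β p

/-- `D_ξ^α p`, for a function `p(x, ξ)` on `ℝⁿ × ℝⁿ`. -/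
def Dxi {n : ℕ} (α : Fin n → ℕ) (p : Euc n × Euc n → ℂ) : Euc n × Euc n → ℂ :=
  multiD (fun i => ((0 : Euc n), EuclideanSpace.single i (1 : ℝ))) α p

/-- The uniform Hörmander class `S^d_{1,0}(ℝⁿ × ℝⁿ)`. -/
def IsSymbol {n : ℕ} (d : ℝ) (p : Euc n × Euc n → ℂ) : Prop :=
  ContDiff ℝ ∞ p ∧
    ∀ α β : Fin n → ℕ, ∃ C : ℝ, ∀ x ξ : Euc n,
      japBracket ξ ^ (-(d - multiLength α)) * ‖Dx β (Dxi α p) (x, ξ)‖ ≤ C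

/-- The inverse Fourier transform on `ℝ`, `(ℱ⁻¹ φ)(ξ) = (2π)⁻¹ ∫ e^{izξ} φ(z) dz`. -/
def invFourierLine (φ : ℝ → ℂ) (ξ : ℝ) : ℂ :=
  ((2 * Real.pi : ℝ) : ℂ)⁻¹ * ∫ z : ℝ, Complex.exp (Complex.I * z * ξ) * φ z

/-- For `f : ℝ → ℂ` continuous of polynomial growth: the restriction to `ℝ ∖ {0}` of the tempered
distribution `ℱ⁻¹ f` is the function `K`, smooth on `ℝ ∖ {0}`. That is,
`⟨ℱ⁻¹ f, φ⟩ = ⟨f, ℱ⁻¹ φ⟩ = ⟨K, φ⟩` for all test functions `φ ∈ C₀^∞(ℝ ∖ {0})`. The values of `K`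
on `ℝ ∖ {0}` are determined by `f`. -/
def IsInvFourierOffZero (f K : ℝ → ℂ) : Prop :=
  ContDiffOn ℝ ∞ K {0}ᶜ ∧
    ∀ φ : ℝ → ℂ, ContDiff ℝ ∞ φ → HasCompactSupport φ → tsupport φ ⊆ {0}ᶜ →
      ∫ ξ : ℝ, f ξ * invFourierLine φ ξ = ∫ z : ℝ, K z * φ z

/-- `z^l D_z^m K(z)` with `D_z = -i d/dz`. -/
def weightedD (l m : ℕ) (K : ℝ → ℂ) (z : ℝ) : ℂ :=
  (z : ℂ) ^ l * ((-Complex.I) ^ m * iteratedDeriv m K z)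

/-- The function `ξₙ ↦ D_ξ^α D_x^β p(x', 0, ξ', ξₙ)` on `ℝ`. -/
def normalSlice {k : ℕ} (p : Euc (k + 1) × Euc (k + 1) → ℂ) (α β : Fin (k + 1) → ℕ)
    (x' ξ' : Euc k) : ℝ → ℂ :=
  fun ξn => Dxi α (Dx β p) (joinLast x' 0, joinLast ξ' ξn)

/-- The class `S^d_{1,0,uttr}` of symbols in `S^d_{1,0}(ℝ^{k+1} × ℝ^{k+1})` satisfying the uniform
two-sided transmission condition at `xₙ = 0`: for each `ξ'` the functions
`zₙ^l D_{zₙ}^m ℱ⁻¹_{ξₙ → zₙ} D_ξ^α D_x^β p(x', 0, ξ)` are bounded in `x'` and `zₙ ≠ 0`. -/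
def IsSymbolUTTR {k : ℕ} (d : ℝ) (p : Euc (k + 1) × Euc (k + 1) → ℂ) : Prop :=
  IsSymbol d p ∧
    ∀ (α β : Fin (k + 1) → ℕ) (l m : ℕ) (ξ' : Euc k), ∃ C : ℝ, ∀ x' : Euc k,
      ∃ K : ℝ → ℂ, IsInvFourierOffZero (normalSlice p α β x' ξ') K ∧
        ∀ z : ℝ, z ≠ 0 → ‖weightedD l m K z‖ ≤ C

/-- The weighted bounds on `zₙ^l D_{zₙ}^m ℱ⁻¹_{ξₙ → zₙ} D_ξ^α D_x^β p(x', 0, ξ)`, uniform in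
`x'`, `ξ'` and `zₙ ≠ 0`. -/
def HasWeightedKernelBounds {k : ℕ} (d : ℝ) (p : Euc (k + 1) × Euc (k + 1) → ℂ) : Prop :=
  ∀ (α β : Fin (k + 1) → ℕ) (l m : ℕ), ∃ C : ℝ, ∀ x' ξ' : Euc k,
    ∃ K : ℝ → ℂ, IsInvFourierOffZero (normalSlice p α β x' ξ') K ∧
      ∀ z : ℝ, z ≠ 0 →
        japBracket ξ' ^ (-(d + 1 - multiLength α - l + m)) * ‖weightedD l m K z‖ ≤ C

/-- `(s_j)`, of which only the members with `j ≤ d - |α|` matter, is a family of symbols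
`s_j(x', ξ') ∈ S^{d-j-|α|}_{1,0}(ℝᵏ × ℝᵏ)` giving, for every `m`, the expansion of
`ξₙ^m D_ξ^α D_x^β p(x', 0, ξ)` in powers of `ξₙ` with the uniform remainder estimate. -/
def IsNormalExpansion {k : ℕ} (d : ℝ) (p : Euc (k + 1) × Euc (k + 1) → ℂ)
    (α β : Fin (k + 1) → ℕ) (s : ℤ → Euc k × Euc k → ℂ) : Prop :=
  (∀ j : ℤ, (j : ℝ) ≤ d - multiLength α → IsSymbol (d - j - multiLength α) (s j)) ∧
    ∀ m : ℕ, ∃ C : ℝ, ∀ (x' ξ' : Euc k) (ξn : ℝ),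
      ‖(ξn : ℂ) ^ m * normalSlice p α β x' ξ' ξn
          - ∑ j ∈ Finset.Icc (-(m : ℤ)) ⌊d - multiLength α⌋, s j (x', ξ') * (ξn : ℂ) ^ (j + m)‖
        ≤ C * japBracket ξ' ^ (d + 1 - multiLength α + m) * (japBracket (joinLast ξ' ξn))⁻¹

/-- `g` is a polynomial function on `ℝᵏ` of (total) degree at most the real number `r`. -/
def IsPolynomialOfDegreeLE {k : ℕ} (r : ℝ) (g : Euc k → ℂ) : Prop :=
  ∃ P : MvPolynomial (Fin k) ℂ, (P.totalDegree : ℝ) ≤ r ∧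
    ∀ ξ : Euc k, g ξ = MvPolynomial.eval (fun i => (ξ i : ℂ)) P

end

/-!
(iii) ⇒ (i) is immediate.

(ii) ⇒ (iii): multiplying a kernel by `zₙ` amounts to applying `D_{ξₙ}` to the symbol, so it
suffices to bound the derivatives of the kernels, without the weight `zₙ^l`. Off `0` the inverse
Fourier transforms of `ξₙ^m D_ξ^α D_x^β p(x', 0, ξ)` and of the remainder `R_m` in (ii) agree, since
they differ by that of a polynomial. With `a = ⟨ξ'⟩`, subtracting from `R_m` the function
`s / (ξₙ - ia)`, where `s = s_{-m-1}` is its leading coefficient, leaves an integrable remainder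
dominated by a multiple of the Poisson kernel `a / (a² + ξₙ²)`; and the inverse transform of
`s / (ξₙ - ia)` is the bounded function `i s e^{-azₙ} 1_{zₙ > 0}`.

(i) ⇒ (ii): at `ξ' = 0` the slice is a polynomial in `ξₙ` plus the Fourier transform of a function
that is rapidly decreasing with its derivatives off its jump at `0`; the jumps of the derivatives
give an expansion in powers of `ξₙ`, uniformly in `x'`. Taylor expansion in `ξ'` around `0` turns
the expansions of all `D_ξ^γ D_x^β p(x', 0, 0, ξₙ)` into one that is uniform for `|ξₙ| ≥ ⟨ξ'⟩`,
because each `ξ'`-derivative lowers the order by one; this is why the coefficients are polynomials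
in `ξ'` of degree at most `d - j - |α|`. Finally the coefficients are locally uniform limits of
slices, so they inherit the derivatives of the slices, and hence the symbol estimates.
-/

section MultiIndex

variable {V : Type*} [NormedAddCommGroup V] [NormedSpace ℝ V] {n : ℕ} {f : V → ℂ}

lemma contDiff_dirDeriv (hf : ContDiff ℝ ∞ f) (v : V) : ContDiff ℝ ∞ (dirDeriv v f) :=
  (hf.fderiv_right (m := ∞) (by simp)).clm_apply contDiff_const

lemma dirDeriv_comm (hf : ContDiff ℝ ∞ f) (v w : V) :
    dirDeriv v (dirDeriv w f) = dirDeriv w (dirDeriv v f) := by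
  have hd : Differentiable ℝ (fderiv ℝ f) :=
    (hf.fderiv_right (m := ∞) (by simp)).differentiable (by simp)
  have second_deriv (a b y : V) :
      dirDeriv a (dirDeriv b f) y = fderiv ℝ (fderiv ℝ f) y a b := by
    change fderiv ℝ (fun y => fderiv ℝ f y b) y a = _
    simp [((hd y).hasFDerivAt.clm_apply (hasFDerivAt_const b y)).fderiv]
  funext y
  have hsymm : IsSymmSndFDerivAt ℝ f y := hf.contDiffAt.isSymmSndFDerivAt (by
    simp only [minSmoothness_of_isRCLikeNormedField]
    exact WithTop.coe_le_coe.2 le_top)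
  rw [second_deriv, second_deriv, hsymm v w]

lemma dirDeriv_const_mul (v : V) (c : ℂ) (f : V → ℂ) :
    dirDeriv v (fun y => c * f y) = fun y => c * dirDeriv v f y := by
  funext y
  change fderiv ℝ (c • f) y v = _
  simp [fderiv_const_smul_field, dirDeriv]

lemma contDiff_iterate_dirDeriv (hf : ContDiff ℝ ∞ f) (v : V) (r : ℕ) :
    ContDiff ℝ ∞ ((dirDeriv v)^[r] f) := by
  induction r generalizing f with
  | zero => exact hf
  | succ _ ih => exact ih (contDiff_dirDeriv hf v)

lemma dirDeriv_iterate_comm (hf : ContDiff ℝ ∞ f) (v w : V) (r : ℕ) :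
    dirDeriv v ((dirDeriv w)^[r] f) = (dirDeriv w)^[r] (dirDeriv v f) := by
  induction r generalizing f with
  | zero => rfl
  | succ r ih =>
    simp only [Function.iterate_succ, Function.comp]
    rw [ih (contDiff_dirDeriv hf w), dirDeriv_comm hf]

lemma iterate_dirDeriv_const_mul (v : V) (c : ℂ) (r : ℕ) (f : V → ℂ) :
    (dirDeriv v)^[r] (fun y => c * f y) = fun y => c * (dirDeriv v)^[r] f y := by
  induction r generalizing f with
  | zero => rfl
  | succ r ih => simp only [Function.iterate_succ, Function.comp, dirDeriv_const_mul, ih]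

/-- The iterated partial derivative `∂^α` restricted to the directions listed in `l`; the operator
`multiD` is the case where `l` lists all directions, and induction on `l` gives its properties. -/
noncomputable def iterDirDeriv (e : Fin n → V) (α : Fin n → ℕ) (l : List (Fin n))
    (f : V → ℂ) : V → ℂ :=
  l.foldr (fun i g => (dirDeriv (e i))^[α i] g) f

lemma multiD_eq (e : Fin n → V) (α : Fin n → ℕ) (f : V → ℂ) :
    multiD e α f = fun y => (-Complex.I) ^ multiLength α *
      iterDirDeriv e α (List.finRange n) f y := rfl

lemma iterDirDeriv_cons (e : Fin n → V) (α : Fin n → ℕ) (i : Fin n) (l : List (Fin n))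
    (f : V → ℂ) : iterDirDeriv e α (i :: l) f = (dirDeriv (e i))^[α i] (iterDirDeriv e α l f) := rfl

lemma contDiff_iterDirDeriv (e : Fin n → V) (α : Fin n → ℕ) (l : List (Fin n))
    (hf : ContDiff ℝ ∞ f) : ContDiff ℝ ∞ (iterDirDeriv e α l f) := by
  induction l with
  | nil => exact hf
  | cons i l ih => exact contDiff_iterate_dirDeriv ih _ _

lemma dirDeriv_iterDirDeriv_comm (e : Fin n → V) (α : Fin n → ℕ) (l : List (Fin n))
    (hf : ContDiff ℝ ∞ f) (v : V) :
    dirDeriv v (iterDirDeriv e α l f) = iterDirDeriv e α l (dirDeriv v f) := by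
  induction l with
  | nil => rfl
  | cons i l ih =>
    rw [iterDirDeriv_cons, iterDirDeriv_cons,
      dirDeriv_iterate_comm (contDiff_iterDirDeriv e α l hf), ih]

lemma iterDirDeriv_const_mul (e : Fin n → V) (α : Fin n → ℕ) (l : List (Fin n)) (c : ℂ)
    (f : V → ℂ) :
    iterDirDeriv e α l (fun y => c * f y) = fun y => c * iterDirDeriv e α l f y := by
  induction l with
  | nil => rfl
  | cons i l ih => rw [iterDirDeriv_cons, iterDirDeriv_cons, ih, iterate_dirDeriv_const_mul]

lemma iterDirDeriv_add_single_of_notMem (e : Fin n → V) (α : Fin n → ℕ)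
    {l : List (Fin n)} (f : V → ℂ) {i : Fin n} (hi : i ∉ l) :
    iterDirDeriv e (α + Pi.single i 1) l f = iterDirDeriv e α l f := by
  induction l with
  | nil => rfl
  | cons j l ih =>
    rw [List.mem_cons, not_or] at hi
    rw [iterDirDeriv_cons, iterDirDeriv_cons, ih hi.2]
    simp [Ne.symm hi.1]

lemma iterDirDeriv_add_single (e : Fin n → V) (α : Fin n → ℕ)
    {l : List (Fin n)} (hl : l.Nodup) (hf : ContDiff ℝ ∞ f) {i : Fin n} (hi : i ∈ l) :
    iterDirDeriv e (α + Pi.single i 1) l f = dirDeriv (e i) (iterDirDeriv e α l f) := by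
  induction l with
  | nil => simp at hi
  | cons j l ih =>
    rw [List.nodup_cons] at hl
    rw [iterDirDeriv_cons, iterDirDeriv_cons,
      dirDeriv_iterate_comm (contDiff_iterDirDeriv e α l hf)]
    by_cases hij : i = j
    · subst hij
      rw [iterDirDeriv_add_single_of_notMem e α f hl.1]
      simp
    · have hi' : i ∈ l := by simpa [hij] using hi
      rw [ih hl.2 hi']
      simp [Ne.symm hij]

lemma multiLength_add (α β : Fin n → ℕ) :
    multiLength (α + β) = multiLength α + multiLength β := by
  simp [multiLength, Finset.sum_add_distrib]

@[simp] lemma multiLength_single (i : Fin n) (r : ℕ) :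
    multiLength (Pi.single i r : Fin n → ℕ) = r := by
  simp [multiLength]

lemma contDiff_multiD (e : Fin n → V) (α : Fin n → ℕ) (hf : ContDiff ℝ ∞ f) :
    ContDiff ℝ ∞ (multiD e α f) :=
  contDiff_const.mul (contDiff_iterDirDeriv e α _ hf)

lemma dirDeriv_multiD (e : Fin n → V) (α : Fin n → ℕ) (hf : ContDiff ℝ ∞ f) (i : Fin n) :
    dirDeriv (e i) (multiD e α f) =
      fun y => Complex.I * multiD e (α + Pi.single i 1) f y := by
  rw [multiD_eq, multiD_eq, dirDeriv_const_mul,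
    iterDirDeriv_add_single e α (List.nodup_finRange n) hf (List.mem_finRange i)]
  funext y
  rw [multiLength_add, multiLength_single, pow_succ]
  linear_combination ((-Complex.I) ^ multiLength α *
    dirDeriv (e i) (iterDirDeriv e α (List.finRange n) f) y) * Complex.I_mul_I

lemma multiD_const_mul (e : Fin n → V) (α : Fin n → ℕ) (c : ℂ) (f : V → ℂ) :
    multiD e α (fun y => c * f y) = fun y => c * multiD e α f y := by
  rw [multiD_eq, multiD_eq, iterDirDeriv_const_mul]
  funext y
  ring

lemma dirDeriv_multiD_comm (e : Fin n → V) (α : Fin n → ℕ) (hf : ContDiff ℝ ∞ f) (v : V) :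
    dirDeriv v (multiD e α f) = multiD e α (dirDeriv v f) := by
  rw [multiD_eq, multiD_eq, dirDeriv_const_mul, dirDeriv_iterDirDeriv_comm e α _ hf]

@[simp] lemma multiD_zero (e : Fin n → V) (f : V → ℂ) : multiD e 0 f = f := by
  have iterDirDeriv_zero (l : List (Fin n)) : iterDirDeriv e 0 l f = f := by
    induction l with
    | nil => rfl
    | cons i l ih => rw [iterDirDeriv_cons, ih]; rfl
  simp [multiD_eq, iterDirDeriv_zero, multiLength]

section ShiftFamily

variable {e : Fin n → V} {F : (Fin n → ℕ) → V → ℂ}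

lemma iterate_dirDeriv_eq_of_shift
    (hF : ∀ α i, dirDeriv (e i) (F α) = fun y => Complex.I * F (α + Pi.single i 1) y)
    (α : Fin n → ℕ) (i : Fin n) (r : ℕ) :
    (dirDeriv (e i))^[r] (F α) = fun y => Complex.I ^ r * F (α + Pi.single i r) y := by
  induction r generalizing α with
  | zero => simp
  | succ r ih =>
    rw [Function.iterate_succ, Function.comp, hF, iterate_dirDeriv_const_mul, ih]
    funext y
    rw [add_assoc, ← Pi.single_add, add_comm 1 r]
    ring

lemma iterDirDeriv_eq_of_shift
    (hF : ∀ α i, dirDeriv (e i) (F α) = fun y => Complex.I * F (α + Pi.single i 1) y)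
    (α γ : Fin n → ℕ) (l : List (Fin n)) :
    iterDirDeriv e γ l (F α) = fun y => Complex.I ^ ((l.map γ).sum) *
      F (α + (l.map fun i => Pi.single i (γ i)).sum) y := by
  induction l with
  | nil => simp [iterDirDeriv]
  | cons i l ih =>
    rw [iterDirDeriv_cons, ih, iterate_dirDeriv_const_mul, iterate_dirDeriv_eq_of_shift hF]
    funext y
    simp only [List.map_cons, List.sum_cons]
    rw [add_assoc, add_comm (List.sum (List.map (fun i => (Pi.single i (γ i) : Fin n → ℕ)) l))]
    ring

lemma multiD_eq_of_shift
    (hF : ∀ α i, dirDeriv (e i) (F α) = fun y => Complex.I * F (α + Pi.single i 1) y)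
    (α γ : Fin n → ℕ) : multiD e γ (F α) = F (α + γ) := by
  have hlength : ((List.finRange n).map γ).sum = multiLength γ := by
    rw [multiLength, ← List.sum_ofFn, List.ofFn_eq_map]
  have hsum : ((List.finRange n).map fun i => (Pi.single i (γ i) : Fin n → ℕ)).sum = γ := by
    rw [← List.ofFn_eq_map, List.sum_ofFn]
    exact Finset.univ_sum_single γ
  funext y
  rw [multiD_eq, iterDirDeriv_eq_of_shift hF, hlength, hsum]
  simp [← mul_assoc, ← mul_pow]

end ShiftFamily

end MultiIndex

section Slices

variable {n k : ℕ}

lemma japBracket_pos (ξ : Euc n) : 0 < japBracket ξ :=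
  Real.sqrt_pos.2 (by positivity)

lemma one_le_japBracket (ξ : Euc n) : 1 ≤ japBracket ξ :=
  Real.one_le_sqrt.2 (by nlinarith [sq_nonneg ‖ξ‖])

lemma japBracket_sq (ξ : Euc n) : japBracket ξ ^ 2 = 1 + ‖ξ‖ ^ 2 :=
  Real.sq_sqrt (by positivity)

lemma norm_le_japBracket (ξ : Euc n) : ‖ξ‖ ≤ japBracket ξ :=
  Real.le_sqrt_of_sq_le (by linarith)

lemma abs_apply_le_japBracket (ξ : Euc n) (i : Fin n) : |ξ i| ≤ japBracket ξ :=
  (by simpa using PiLp.norm_apply_le ξ i : |ξ i| ≤ ‖ξ‖).trans (norm_le_japBracket ξ)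

lemma joinLast_castSucc (x : Euc k) (t : ℝ) (i : Fin k) : joinLast x t i.castSucc = x i := by
  simp [joinLast]

lemma joinLast_last (x : Euc k) (t : ℝ) : joinLast x t (Fin.last k) = t := by
  simp [joinLast]

lemma japBracket_joinLast_sq (x : Euc k) (t : ℝ) :
    japBracket (joinLast x t) ^ 2 = japBracket x ^ 2 + t ^ 2 := by
  rw [japBracket_sq, japBracket_sq, EuclideanSpace.norm_sq_eq, EuclideanSpace.norm_sq_eq,
    Fin.sum_univ_castSucc]
  simp only [joinLast_castSucc, joinLast_last, Real.norm_eq_abs, sq_abs]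
  ring

lemma abs_le_japBracket_joinLast (x : Euc k) (t : ℝ) : |t| ≤ japBracket (joinLast x t) := by
  simpa only [joinLast_last] using abs_apply_le_japBracket (joinLast x t) (Fin.last k)

lemma japBracket_le_japBracket_joinLast (x : Euc k) (t : ℝ) :
    japBracket x ≤ japBracket (joinLast x t) :=
  le_of_sq_le_sq (by rw [japBracket_joinLast_sq]; linarith [sq_nonneg t]) (japBracket_pos _).le

/-- The linear embedding `x' ↦ (x', 0)` of `ℝᵏ` into `ℝ^{k+1}`. -/
noncomputable def tangentialEmbedding (k : ℕ) : Euc k →L[ℝ] Euc (k + 1) :=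
  ∑ i, (EuclideanSpace.proj (𝕜 := ℝ) i).smulRight (EuclideanSpace.single i.castSucc (1 : ℝ))

lemma tangentialEmbedding_apply (x : Euc k) :
    tangentialEmbedding k x = ∑ i, x i • EuclideanSpace.single i.castSucc (1 : ℝ) := by
  simp [tangentialEmbedding]

lemma joinLast_eq (x : Euc k) (t : ℝ) :
    joinLast x t = tangentialEmbedding k x + t • EuclideanSpace.single (Fin.last k) (1 : ℝ) := by
  ext j
  rw [tangentialEmbedding_apply]
  refine Fin.lastCases ?_ (fun i => ?_) j
  · rw [joinLast_last]
    simp [(Fin.castSucc_ne_last _).symm]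
  · rw [joinLast_castSucc]
    simp [Pi.single_apply, Fin.castSucc_ne_last]

lemma hasDerivAt_joinLast (x : Euc k) (t : ℝ) :
    HasDerivAt (joinLast x) (EuclideanSpace.single (Fin.last k) (1 : ℝ)) t := by
  rw [funext (joinLast_eq x)]
  simpa using ((hasDerivAt_id t).smul_const _).const_add (tangentialEmbedding k x)

lemma hasFDerivAt_joinLast (x : Euc k) (t : ℝ) :
    HasFDerivAt (joinLast · t) (tangentialEmbedding k) x := by
  simp only [joinLast_eq]
  exact (tangentialEmbedding k).hasFDerivAt.add_const _

/-- The real-linear form `(v, w) ↦ ∑ vᵢ aᵢ + ∑ wᵢ bᵢ` on `ℝᵏ × ℝᵏ`, as a linear function of the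
two lists `a`, `b` of partial derivatives. -/
noncomputable def gradCLM :
    (Fin k → ℂ) × (Fin k → ℂ) →ₗ[ℂ] Euc k × Euc k →L[ℝ] ℂ where
  toFun g :=
    ∑ i, ((EuclideanSpace.proj i).comp (ContinuousLinearMap.fst ℝ _ _)).smulRight (g.1 i) +
    ∑ i, ((EuclideanSpace.proj i).comp (ContinuousLinearMap.snd ℝ _ _)).smulRight (g.2 i)
  map_add' g h := by
    refine ContinuousLinearMap.ext fun ⟨v, w⟩ => ?_
    simp only [_root_.add_apply, _root_.sum_apply, ContinuousLinearMap.smulRight_apply,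
      Prod.fst_add, Prod.snd_add, Pi.add_apply, smul_add, Finset.sum_add_distrib]
    exact add_add_add_comm _ _ _ _
  map_smul' c g := by
    refine ContinuousLinearMap.ext fun ⟨v, w⟩ => ?_
    simp [Finset.mul_sum, mul_left_comm]

lemma gradCLM_apply (g : (Fin k → ℂ) × (Fin k → ℂ)) (v w : Euc k) :
    gradCLM g (v, w) = ∑ i, v i • g.1 i + ∑ i, w i • g.2 i := by
  simp [gradCLM]

variable {d : ℝ} {p : Euc n × Euc n → ℂ} {q : Euc (k + 1) × Euc (k + 1) → ℂ}

lemma contDiff_Dxi_Dx (hp : ContDiff ℝ ∞ p) (α β : Fin n → ℕ) : ContDiff ℝ ∞ (Dxi α (Dx β p)) :=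
  contDiff_multiD _ _ (contDiff_multiD _ _ hp)

lemma dirDeriv_Dxi_Dx_snd (hp : ContDiff ℝ ∞ p) (α β : Fin n → ℕ) (i : Fin n) :
    dirDeriv ((0 : Euc n), EuclideanSpace.single i (1 : ℝ)) (Dxi α (Dx β p)) =
      fun y => Complex.I * Dxi (α + Pi.single i 1) (Dx β p) y :=
  dirDeriv_multiD (fun i => ((0 : Euc n), EuclideanSpace.single i (1 : ℝ))) α
    (contDiff_multiD _ _ hp) i

lemma dirDeriv_Dxi_Dx_fst (hp : ContDiff ℝ ∞ p) (α β : Fin n → ℕ) (i : Fin n) :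
    dirDeriv (EuclideanSpace.single i (1 : ℝ), (0 : Euc n)) (Dxi α (Dx β p)) =
      fun y => Complex.I * Dxi α (Dx (β + Pi.single i 1) p) y := by
  have hDx : ContDiff ℝ ∞ (Dx β p) := contDiff_multiD _ _ hp
  rw [Dxi, dirDeriv_multiD_comm _ _ hDx, Dx,
    dirDeriv_multiD (fun i => (EuclideanSpace.single i (1 : ℝ), (0 : Euc n))) β hp i,
    multiD_const_mul]
  rfl

lemma Dx_Dxi_comm (hp : ContDiff ℝ ∞ p) (α β : Fin n → ℕ) :
    Dx β (Dxi α p) = Dxi α (Dx β p) := by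
  have := multiD_eq_of_shift (e := fun i => (EuclideanSpace.single i (1 : ℝ), (0 : Euc n)))
    (F := fun β => Dxi α (Dx β p)) (fun β i => dirDeriv_Dxi_Dx_fst hp α β i) 0 β
  simpa [Dx] using this

lemma IsSymbol.norm_normalSlice_le (hq : IsSymbol d q) (α β : Fin (k + 1) → ℕ) :
    ∃ C : ℝ, 0 ≤ C ∧ ∀ (x ξ : Euc k) (t : ℝ), ‖normalSlice q α β x ξ t‖ ≤
      C * japBracket (joinLast ξ t) ^ (d - multiLength α) := by
  obtain ⟨C, hC⟩ := hq.2 α β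
  refine ⟨max C 0, le_max_right _ _, fun x ξ t => ?_⟩
  have hpos := Real.rpow_pos_of_pos (japBracket_pos (joinLast ξ t)) (d - multiLength α)
  have hbound := hC (joinLast x 0) (joinLast ξ t)
  rw [Dx_Dxi_comm hq.1, Real.rpow_neg (japBracket_pos _).le, inv_mul_le_iff₀ hpos,
    mul_comm] at hbound
  exact hbound.trans (mul_le_mul_of_nonneg_right (le_max_left _ _) hpos.le)

lemma hasDerivAt_normalSlice (hq : ContDiff ℝ ∞ q) (α β : Fin (k + 1) → ℕ) (x ξ : Euc k) (t : ℝ) :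
    HasDerivAt (normalSlice q α β x ξ)
      (Complex.I * normalSlice q (α + Pi.single (Fin.last k) 1) β x ξ t) t := by
  have houter := ((contDiff_Dxi_Dx hq α β).differentiable (by simp)
    (joinLast x 0, joinLast ξ t)).hasFDerivAt
  have hinner := (hasDerivAt_const t (joinLast x 0)).prodMk (hasDerivAt_joinLast ξ t)
  have hpartial := congrFun (dirDeriv_Dxi_Dx_snd hq α β (Fin.last k)) (joinLast x 0, joinLast ξ t)
  simp only [dirDeriv] at hpartial
  have h := houter.comp_hasDerivAt t hinner
  rw [hpartial] at h
  exact h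

lemma hasFDerivAt_normalSlice (hq : ContDiff ℝ ∞ q) (α β : Fin (k + 1) → ℕ) (t : ℝ)
    (y : Euc k × Euc k) :
    HasFDerivAt (fun y : Euc k × Euc k => normalSlice q α β y.1 y.2 t)
      (Complex.I • gradCLM
        (fun i => normalSlice q α (β + Pi.single i.castSucc 1) y.1 y.2 t,
          fun i => normalSlice q (α + Pi.single i.castSucc 1) β y.1 y.2 t)) y := by
  have houter := ((contDiff_Dxi_Dx hq α β).differentiable (by simp)
    (joinLast y.1 0, joinLast y.2 t)).hasFDerivAt
  have hinner := ((hasFDerivAt_joinLast y.1 0).comp y hasFDerivAt_fst).prodMk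
    ((hasFDerivAt_joinLast y.2 t).comp y hasFDerivAt_snd)
  refine (houter.comp y hinner).congr_fderiv (ContinuousLinearMap.ext fun ⟨v, w⟩ => ?_)
  have hfst := fun i => congrFun (dirDeriv_Dxi_Dx_fst hq α β i) (joinLast y.1 0, joinLast y.2 t)
  have hsnd := fun i => congrFun (dirDeriv_Dxi_Dx_snd hq α β i) (joinLast y.1 0, joinLast y.2 t)
  simp only [dirDeriv] at hfst hsnd
  have hdirection : (tangentialEmbedding k v, tangentialEmbedding k w) =
      ∑ i, v i • (EuclideanSpace.single i.castSucc (1 : ℝ), (0 : Euc (k + 1))) +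
      ∑ i, w i • ((0 : Euc (k + 1)), EuclideanSpace.single i.castSucc (1 : ℝ)) := by
    simp [tangentialEmbedding_apply, Prod.ext_iff, Prod.fst_sum, Prod.snd_sum]
  change fderiv ℝ _ _ (tangentialEmbedding k v, tangentialEmbedding k w) = _
  rw [hdirection, map_add, map_sum, map_sum]
  simp only [map_smul, hfst, hsnd, smul_add, _root_.smul_apply, gradCLM_apply, Finset.smul_sum,
    smul_comm Complex.I]
  rfl

end Slices

section Fourier

open MeasureTheory FourierTransform Filter Topology

/-- The Fourier transform on `ℝ`, `(ℱ K)(t) = ∫ e^{-izt} K(z) dz`. -/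
noncomputable def lineFourier (K : ℝ → ℂ) (t : ℝ) : ℂ :=
  ∫ z : ℝ, Complex.exp (-Complex.I * z * t) * K z

lemma lineFourier_eq_vectorFourier (K : ℝ → ℂ) :
    lineFourier K = VectorFourier.fourierIntegral Real.probChar volume (LinearMap.mul ℝ ℝ) K := by
  funext t
  simp only [lineFourier, VectorFourier.fourierIntegral_probChar, LinearMap.mul_apply',
    smul_eq_mul]
  congr! 4 with z
  push_cast
  ring_nf

lemma lineFourier_eq_fourier (K : ℝ → ℂ) (t : ℝ) :
    lineFourier K t = 𝓕 K (t / (2 * Real.pi)) := by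
  rw [lineFourier, Real.fourier_real_eq_integral_exp_smul]
  congr! 4 with z
  push_cast
  field_simp

lemma invFourierLine_eq_lineFourier (φ : ℝ → ℂ) (ξ : ℝ) :
    invFourierLine φ ξ = ((2 * Real.pi : ℝ) : ℂ)⁻¹ * lineFourier φ (-ξ) := by
  simp only [invFourierLine, lineFourier]
  push_cast
  simp only [mul_neg, neg_mul, neg_neg]

variable {f g : ℝ → ℂ}

lemma norm_lineFourier_le (f : ℝ → ℂ) (t : ℝ) : ‖lineFourier f t‖ ≤ ∫ z, ‖f z‖ := by
  rw [lineFourier_eq_vectorFourier]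
  exact VectorFourier.norm_fourierIntegral_le_integral_norm ..

lemma continuous_lineFourier (hf : Integrable f) : Continuous (lineFourier f) := by
  rw [lineFourier_eq_vectorFourier]
  exact VectorFourier.fourierIntegral_continuous Real.continuous_probChar (by fun_prop) hf

lemma integrable_exp_neg_mul (hf : Integrable f) (t : ℝ) :
    Integrable fun z : ℝ => Complex.exp (-Complex.I * z * t) * f z := by
  have hbounded (z : ℝ) : ‖Complex.exp (-Complex.I * z * t)‖ ≤ 1 := by
    simp [Complex.norm_exp]
  exact hf.bdd_mul (Continuous.aestronglyMeasurable (by fun_prop)) (Eventually.of_forall hbounded)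

lemma integral_lineFourier_mul (hf : Integrable f) (hg : Integrable g) :
    ∫ t, lineFourier f t * g t = ∫ z, f z * lineFourier g z := by
  have hflip : (LinearMap.mul ℝ ℝ).flip = LinearMap.mul ℝ ℝ := by ext; simp
  have h := VectorFourier.integral_fourierIntegral_smul_eq_flip (L := LinearMap.mul ℝ ℝ)
    Real.continuous_probChar (by fun_prop) hf hg
  simpa only [lineFourier_eq_vectorFourier, hflip, smul_eq_mul] using h

lemma lineFourier_const_mul (c : ℂ) (f : ℝ → ℂ) (t : ℝ) :
    lineFourier (fun z => c * f z) t = c * lineFourier f t := by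
  simp only [lineFourier, mul_left_comm _ c, integral_const_mul]

lemma hasDerivAt_lineFourier (hf : Integrable f) (hzf : Integrable fun z : ℝ => (z : ℂ) * f z)
    (t : ℝ) :
    HasDerivAt (lineFourier f) (lineFourier (fun z : ℝ => -Complex.I * z * f z) t) t := by
  have hinner : HasDerivAt (fun t : ℝ => t / (2 * Real.pi)) (2 * Real.pi)⁻¹ t := by
    simpa using (hasDerivAt_id t).div_const (2 * Real.pi)
  have houter := (Real.hasDerivAt_fourier hf hzf (t / (2 * Real.pi))).scomp t hinner
  rw [funext (lineFourier_eq_fourier f), lineFourier_eq_fourier]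
  refine houter.congr_deriv ?_
  rw [← lineFourier_eq_fourier, ← lineFourier_eq_fourier, Complex.real_smul,
    ← lineFourier_const_mul]
  congr! 2 with z
  rw [smul_eq_mul]
  push_cast
  field_simp

lemma lineFourier_deriv (h : ∀ z, HasDerivAt f (g z) z) (hf : Integrable f) (hg : Integrable g)
    (t : ℝ) : lineFourier g t = Complex.I * t * lineFourier f t := by
  have hderiv : deriv f = g := funext fun z => (h z).deriv
  rw [← hderiv] at hg ⊢
  rw [lineFourier_eq_fourier, lineFourier_eq_fourier,
    Real.fourier_deriv hf (fun z => (h z).differentiableAt) hg]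
  simp only [smul_eq_mul]
  push_cast
  field_simp

lemma continuous_invFourierLine (hf : Integrable f) : Continuous (invFourierLine f) := by
  rw [funext (invFourierLine_eq_lineFourier f)]
  exact continuous_const.mul ((continuous_lineFourier hf).comp continuous_neg)

lemma norm_invFourierLine_le (f : ℝ → ℂ) (ξ : ℝ) : ‖invFourierLine f ξ‖ ≤ ∫ z, ‖f z‖ := by
  have hconst : ‖((2 * Real.pi : ℝ) : ℂ)⁻¹‖ ≤ 1 := by
    rw [norm_inv, Complex.norm_real, Real.norm_of_nonneg Real.two_pi_pos.le]
    exact inv_le_one_of_one_le₀ (by linarith [Real.pi_gt_three])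
  rw [invFourierLine_eq_lineFourier, norm_mul]
  exact (mul_le_of_le_one_left (norm_nonneg _) hconst).trans (norm_lineFourier_le f _)

lemma invFourierLine_const_mul (c : ℂ) (f : ℝ → ℂ) (ξ : ℝ) :
    invFourierLine (fun z => c * f z) ξ = c * invFourierLine f ξ := by
  simp only [invFourierLine_eq_lineFourier, lineFourier_const_mul, mul_left_comm]

lemma integral_mul_invFourierLine (hf : Integrable f) (hg : Integrable g) :
    ∫ ξ, f ξ * invFourierLine g ξ = ∫ z, invFourierLine f z * g z := by
  have hreflect : (fun ξ => lineFourier f (-ξ)) = lineFourier fun z => f (-z) := by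
    funext ξ
    rw [lineFourier, lineFourier, ← integral_neg_eq_self]
    simp
  have hneg := integral_lineFourier_mul hf.comp_neg hg
  rw [← hreflect, ← integral_neg_eq_self fun z => f (-z) * lineFourier g z] at hneg
  simp only [neg_neg] at hneg
  simp only [invFourierLine_eq_lineFourier, mul_left_comm _ (((2 * Real.pi : ℝ) : ℂ)⁻¹), mul_assoc,
    integral_const_mul, hneg]

lemma hasDerivAt_invFourierLine (hf : Integrable f)
    (hzf : Integrable fun z : ℝ => (z : ℂ) * f z) (ξ : ℝ) :
    HasDerivAt (invFourierLine f) (invFourierLine (fun z : ℝ => Complex.I * z * f z) ξ) ξ := by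
  have h := ((hasDerivAt_lineFourier hf hzf (-ξ)).scomp ξ (hasDerivAt_neg ξ)).const_mul
    (((2 * Real.pi : ℝ) : ℂ)⁻¹)
  rw [funext (invFourierLine_eq_lineFourier f), invFourierLine_eq_lineFourier]
  refine h.congr_deriv ?_
  rw [Complex.real_smul, ← lineFourier_const_mul]
  congr! 2 with z
  push_cast
  ring_nf

lemma invFourierLine_deriv (h : ∀ z, HasDerivAt f (g z) z) (hf : Integrable f) (hg : Integrable g)
    (ξ : ℝ) : invFourierLine g ξ = -Complex.I * ξ * invFourierLine f ξ := by
  rw [invFourierLine_eq_lineFourier, invFourierLine_eq_lineFourier, lineFourier_deriv h hf hg]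
  push_cast
  ring_nf

lemma lineFourier_invFourierLine (hc : Continuous f) (hf : Integrable f)
    (hF : Integrable (invFourierLine f)) (z : ℝ) : lineFourier (invFourierLine f) z = f z := by
  have htwo_pi : ((2 * Real.pi : ℝ) : ℂ) ≠ 0 := by exact_mod_cast Real.two_pi_pos.ne'
  have hfourierInv (η : ℝ) :
      𝓕⁻ f η = ((2 * Real.pi : ℝ) : ℂ) * invFourierLine f (2 * Real.pi * η) := by
    rw [invFourierLine_eq_lineFourier, mul_inv_cancel_left₀ htwo_pi, lineFourier_eq_fourier,
      Real.fourierInv_eq_fourier_neg, neg_div, mul_div_cancel_left₀ _ Real.two_pi_pos.ne']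
  have hint : Integrable (𝓕 f) := by
    have := ((hF.comp_mul_left' Real.two_pi_pos.ne').const_mul ((2 * Real.pi : ℝ) : ℂ)).comp_neg
    refine this.congr (Eventually.of_forall fun η => ?_)
    simp only [← hfourierInv, Real.fourierInv_eq_fourier_neg, neg_neg]
  have hscale := Measure.integral_comp_mul_left (fun ξ : ℝ =>
    Complex.exp (-Complex.I * ξ * z) * invFourierLine f ξ) (2 * Real.pi)
  rw [abs_of_pos (inv_pos.2 Real.two_pi_pos), eq_inv_smul_iff₀ Real.two_pi_pos.ne'] at hscale
  rw [← congrFun (hc.fourier_fourierInv_eq hf hint) z, Real.fourier_real_eq_integral_exp_smul,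
    lineFourier, ← hscale, Complex.real_smul, ← integral_const_mul]
  refine integral_congr_ae (Eventually.of_forall fun η => ?_)
  simp only [hfourierInv, smul_eq_mul, mul_left_comm _ ((2 * Real.pi : ℝ) : ℂ)]
  congr 3
  push_cast
  ring_nf

lemma integrable_of_norm_le_inv_one_add_sq (hm : AEStronglyMeasurable f) {C : ℝ}
    (h : ∀ᵐ z : ℝ, ‖f z‖ ≤ C * (1 + z ^ 2)⁻¹) : Integrable f :=
  (integrable_inv_one_add_sq.const_mul C).mono' hm h

lemma integral_norm_le_of_le_inv_one_add_sq {C : ℝ}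
    (h : ∀ᵐ z : ℝ, ‖f z‖ ≤ C * (1 + z ^ 2)⁻¹) : ∫ z, ‖f z‖ ≤ C * Real.pi := by
  rw [← integral_univ_inv_one_add_sq, ← integral_const_mul]
  exact integral_mono_of_nonneg (Eventually.of_forall fun z => norm_nonneg _)
    (integrable_inv_one_add_sq.const_mul C) h

end Fourier

section OffZero

open MeasureTheory Filter Topology

/-- Test functions on `ℝ ∖ {0}`. -/
structure IsTestOffZero (φ : ℝ → ℂ) : Prop where
  contDiff : ContDiff ℝ ∞ φ
  hasCompactSupport : HasCompactSupport φ
  tsupport_subset : tsupport φ ⊆ {0}ᶜ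

/-- The restriction of `ℱ⁻¹ f` to `ℝ ∖ {0}` is the function `K`; this is `IsInvFourierOffZero`
without the smoothness of `K`. -/
def RepOffZero (f K : ℝ → ℂ) : Prop :=
  ∀ φ : ℝ → ℂ, IsTestOffZero φ → ∫ ξ : ℝ, f ξ * invFourierLine φ ξ = ∫ z : ℝ, K z * φ z

/-- Continuous functions of polynomial growth. -/
def PolyGrowth (f : ℝ → ℂ) : Prop :=
  Continuous f ∧ ∃ (C : ℝ) (N : ℕ), ∀ t : ℝ, ‖f t‖ ≤ C * (1 + |t|) ^ N

lemma isInvFourierOffZero_iff {f K : ℝ → ℂ} :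
    IsInvFourierOffZero f K ↔ ContDiffOn ℝ ∞ K {0}ᶜ ∧ RepOffZero f K :=
  ⟨fun h => ⟨h.1, fun φ hφ => h.2 φ hφ.1 hφ.2 hφ.3⟩,
    fun h => ⟨h.1, fun φ h1 h2 h3 => h.2 φ ⟨h1, h2, h3⟩⟩⟩

lemma contDiffOn_I_mul : ContDiffOn ℝ ∞ (fun z : ℝ => Complex.I * z) {0}ᶜ :=
  (contDiff_const.mul Complex.ofRealCLM.contDiff).contDiffOn

namespace IsTestOffZero

variable {φ : ℝ → ℂ}

lemma integrable (hφ : IsTestOffZero φ) : Integrable φ :=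
  hφ.contDiff.continuous.integrable_of_hasCompactSupport hφ.hasCompactSupport

lemma deriv (hφ : IsTestOffZero φ) : IsTestOffZero (deriv φ) where
  contDiff := (contDiff_infty_iff_deriv.1 hφ.contDiff).2
  hasCompactSupport := hφ.hasCompactSupport.deriv
  tsupport_subset := (closure_minimal support_deriv_subset
    (isClosed_tsupport φ)).trans hφ.tsupport_subset

lemma hasDerivAt (hφ : IsTestOffZero φ) (z : ℝ) : HasDerivAt φ (_root_.deriv φ z) z :=
  (hφ.contDiff.differentiable (by simp) z).hasDerivAt

lemma mul (hφ : IsTestOffZero φ) {g : ℝ → ℂ} (hg : ContDiffOn ℝ ∞ g {0}ᶜ) :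
    IsTestOffZero fun z => g z * φ z where
  contDiff := by
    refine contDiff_iff_contDiffAt.2 fun z => ?_
    by_cases hz : z ∈ tsupport φ
    · exact (hg.contDiffAt (isOpen_compl_singleton.mem_nhds (hφ.tsupport_subset hz))).mul
        hφ.contDiff.contDiffAt
    · refine (contDiffAt_const (c := (0 : ℂ))).congr_of_eventuallyEq ?_
      filter_upwards [notMem_tsupport_iff_eventuallyEq.1 hz] with y hy
      simp [hy]
  hasCompactSupport := hφ.hasCompactSupport.mul_left
  tsupport_subset := tsupport_mul_subset_right.trans hφ.tsupport_subset

lemma apply_zero (hφ : IsTestOffZero φ) : φ 0 = 0 :=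
  image_eq_zero_of_notMem_tsupport fun h => hφ.tsupport_subset h rfl

lemma invFourierLine_deriv (hφ : IsTestOffZero φ) (ξ : ℝ) :
    invFourierLine (_root_.deriv φ) ξ = -Complex.I * ξ * invFourierLine φ ξ :=
  _root_.invFourierLine_deriv hφ.hasDerivAt hφ.integrable hφ.deriv.integrable ξ

lemma hasDerivAt_invFourierLine (hφ : IsTestOffZero φ) (ξ : ℝ) :
    HasDerivAt (invFourierLine φ) (invFourierLine (fun z : ℝ => Complex.I * z * φ z) ξ) ξ :=
  _root_.hasDerivAt_invFourierLine hφ.integrable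
    (hφ.mul Complex.ofRealCLM.contDiff.contDiffOn).integrable ξ

lemma pow_mul_norm_invFourierLine_le (hφ : IsTestOffZero φ) (N : ℕ) :
    ∃ C : ℝ, ∀ ξ : ℝ, (1 + |ξ|) ^ N * ‖invFourierLine φ ξ‖ ≤ C := by
  induction N generalizing φ with
  | zero => exact ⟨∫ z, ‖φ z‖, fun ξ => by simpa using norm_invFourierLine_le φ ξ⟩
  | succ N ih =>
    obtain ⟨C, hC⟩ := ih hφ
    obtain ⟨C', hC'⟩ := ih hφ.deriv
    refine ⟨C + C', fun ξ => ?_⟩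
    have hderiv : ‖invFourierLine (_root_.deriv φ) ξ‖ = |ξ| * ‖invFourierLine φ ξ‖ := by
      simp [hφ.invFourierLine_deriv]
    calc (1 + |ξ|) ^ (N + 1) * ‖invFourierLine φ ξ‖
        = (1 + |ξ|) ^ N * ‖invFourierLine φ ξ‖
          + (1 + |ξ|) ^ N * ‖invFourierLine (_root_.deriv φ) ξ‖ := by rw [hderiv]; ring
      _ ≤ C + C' := add_le_add (hC ξ) (hC' ξ)

end IsTestOffZero

namespace PolyGrowth

variable {f g : ℝ → ℂ} {φ : ℝ → ℂ}

lemma integrable_mul (hf : PolyGrowth f) (hφ : IsTestOffZero φ) :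
    Integrable fun ξ => f ξ * invFourierLine φ ξ := by
  obtain ⟨hc, C, N, hC⟩ := hf
  obtain ⟨A, hA⟩ := hφ.pow_mul_norm_invFourierLine_le (N + 2)
  have hC0 : 0 ≤ C := by simpa using (norm_nonneg _).trans (hC 0)
  refine integrable_of_norm_le_inv_one_add_sq (C := C * A)
    (hc.mul (continuous_invFourierLine hφ.integrable)).aestronglyMeasurable
    (Eventually.of_forall fun ξ => ?_)
  have hsq : 1 + ξ ^ 2 ≤ (1 + |ξ|) ^ 2 := by
    rw [← sq_abs]
    nlinarith [abs_nonneg ξ]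
  rw [← div_eq_mul_inv, le_div_iff₀ (by positivity), norm_mul]
  calc ‖f ξ‖ * ‖invFourierLine φ ξ‖ * (1 + ξ ^ 2)
      ≤ (C * (1 + |ξ|) ^ N) * ‖invFourierLine φ ξ‖ * (1 + |ξ|) ^ 2 := by
        gcongr
        exact hC ξ
    _ = C * ((1 + |ξ|) ^ (N + 2) * ‖invFourierLine φ ξ‖) := by ring
    _ ≤ C * A := by gcongr; exact hA ξ

lemma id_mul (hf : PolyGrowth f) : PolyGrowth fun t : ℝ => (t : ℂ) * f t := by
  obtain ⟨hc, C, N, hC⟩ := hf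
  refine ⟨by fun_prop, C, N + 1, fun t => ?_⟩
  rw [norm_mul, Complex.norm_real, Real.norm_eq_abs, pow_succ, ← mul_assoc, mul_comm]
  have hpos := (norm_nonneg _).trans (hC t)
  gcongr
  · exact hC t
  · linarith

lemma const_mul (hf : PolyGrowth f) (c : ℂ) : PolyGrowth fun t : ℝ => c * f t := by
  obtain ⟨hc, C, N, hC⟩ := hf
  refine ⟨by fun_prop, ‖c‖ * C, N, fun t => ?_⟩
  rw [norm_mul, mul_assoc]
  gcongr
  exact hC t

lemma add (hf : PolyGrowth f) (hg : PolyGrowth g) : PolyGrowth fun t : ℝ => f t + g t := by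
  obtain ⟨hc, C, N, hC⟩ := hf
  obtain ⟨hc', C', N', hC'⟩ := hg
  have hC0 : 0 ≤ C := by simpa using (norm_nonneg _).trans (hC 0)
  have hC0' : 0 ≤ C' := by simpa using (norm_nonneg _).trans (hC' 0)
  refine ⟨by fun_prop, C + C', N + N', fun t => ?_⟩
  have hbase : 1 ≤ 1 + |t| := by linarith [abs_nonneg t]
  rw [add_mul]
  refine norm_add_le_of_le ((hC t).trans ?_) ((hC' t).trans ?_)
  · exact mul_le_mul_of_nonneg_left (pow_le_pow_right₀ hbase (Nat.le_add_right N N')) hC0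
  · exact mul_le_mul_of_nonneg_left (pow_le_pow_right₀ hbase (Nat.le_add_left N' N)) hC0'

lemma pow_mul (hf : PolyGrowth f) (m : ℕ) : PolyGrowth fun t : ℝ => (t : ℂ) ^ m * f t := by
  induction m with
  | zero => simpa using hf
  | succ m ih => simpa only [pow_succ', mul_assoc] using ih.id_mul

lemma one : PolyGrowth fun _ => 1 :=
  ⟨continuous_const, 1, 0, fun t => by simp⟩

lemma sum {ι : Type*} (S : Finset ι) {F : ι → ℝ → ℂ} (h : ∀ i ∈ S, PolyGrowth (F i)) :
    PolyGrowth fun t => ∑ i ∈ S, F i t := by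
  classical
  induction S using Finset.induction_on with
  | empty => exact ⟨by simpa using continuous_const, 0, 0, fun t => by simp⟩
  | insert i S hi ih =>
    simp only [Finset.sum_insert hi]
    exact (h i (by simp)).add (ih fun j hj => h j (by simp [hj]))

end PolyGrowth

namespace IsTestOffZero

variable {φ K : ℝ → ℂ}

lemma integrable_invFourierLine (hφ : IsTestOffZero φ) : Integrable (invFourierLine φ) := by
  simpa using PolyGrowth.one.integrable_mul hφ

lemma lineFourier_invFourierLine (hφ : IsTestOffZero φ) (z : ℝ) :
    lineFourier (invFourierLine φ) z = φ z :=
  _root_.lineFourier_invFourierLine hφ.contDiff.continuous hφ.integrable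
    hφ.integrable_invFourierLine z

lemma integrable_mul (hφ : IsTestOffZero φ) (hK : ContinuousOn K {0}ᶜ) :
    Integrable fun z => K z * φ z := by
  refine Continuous.integrable_of_hasCompactSupport ?_ hφ.hasCompactSupport.mul_left
  refine continuous_of_tsupport fun z hz => ?_
  have hz' : z ∈ ({0} : Set ℝ)ᶜ := hφ.tsupport_subset (tsupport_mul_subset_right hz)
  exact (hK.continuousAt (isOpen_compl_singleton.mem_nhds hz')).mul
    hφ.contDiff.continuous.continuousAt

end IsTestOffZero

namespace RepOffZero

variable {f g K L : ℝ → ℂ}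

lemma of_integrable (hf : Integrable f) : RepOffZero f (invFourierLine f) :=
  fun _ hφ => integral_mul_invFourierLine hf hφ.integrable

lemma lineFourier_of_integrable (hK : Integrable K) : RepOffZero (lineFourier K) K := by
  intro φ hφ
  simp only [integral_lineFourier_mul hK hφ.integrable_invFourierLine,
    hφ.lineFourier_invFourierLine]

lemma const_mul (h : RepOffZero f K) (c : ℂ) :
    RepOffZero (fun t => c * f t) (fun z => c * K z) := by
  intro φ hφ
  simp only [mul_assoc, integral_const_mul, h φ hφ]

lemma add (hf : PolyGrowth f) (hg : PolyGrowth g) (hK : ContinuousOn K {0}ᶜ)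
    (hL : ContinuousOn L {0}ᶜ) (h : RepOffZero f K) (h' : RepOffZero g L) :
    RepOffZero (fun t => f t + g t) (fun z => K z + L z) := by
  intro φ hφ
  simp only [add_mul]
  rw [integral_add (hf.integrable_mul hφ) (hg.integrable_mul hφ),
    integral_add (hφ.integrable_mul hK) (hφ.integrable_mul hL), h φ hφ, h' φ hφ]

lemma one : RepOffZero (fun _ => 1) 0 := by
  intro φ hφ
  have hinv := hφ.lineFourier_invFourierLine 0
  simp only [lineFourier, hφ.apply_zero] at hinv
  simpa using hinv

lemma id_mul (hK : ContDiffOn ℝ ∞ K {0}ᶜ) (h : RepOffZero f K) :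
    RepOffZero (fun t : ℝ => Complex.I * t * f t) (deriv K) := by
  intro φ hφ
  have hKd (z : ℝ) (hz : z ∈ ({0} : Set ℝ)ᶜ) : HasDerivAt K (deriv K z) z :=
    ((hK.differentiableOn (by simp) z hz).differentiableAt
      (isOpen_compl_singleton.mem_nhds hz)).hasDerivAt
  have hdK : ContinuousOn (deriv K) {0}ᶜ :=
    hK.continuousOn_deriv_of_isOpen isOpen_compl_singleton (by simp)
  have hparts := integral_mul_deriv_eq_deriv_mul_of_integrable (u := K) (v := φ)
    (fun z hz => hKd z (hφ.tsupport_subset hz)) (fun z _ => hφ.hasDerivAt z)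
    (hφ.deriv.integrable_mul hK.continuousOn) (hφ.integrable_mul hdK)
    (hφ.integrable_mul hK.continuousOn)
  refine neg_injective ((Eq.trans ?_ (h _ hφ.deriv)).trans hparts)
  rw [← integral_neg]
  congr! 2 with ξ
  rw [hφ.invFourierLine_deriv]
  ring

lemma integral_deriv_mul_invFourierLine {f' φ : ℝ → ℂ} (hd : ∀ t, HasDerivAt f (f' t) t)
    (hf : PolyGrowth f) (hf' : PolyGrowth f') (hφ : IsTestOffZero φ) :
    ∫ ξ, f' ξ * invFourierLine φ ξ =
      -∫ ξ, f ξ * invFourierLine (fun z : ℝ => Complex.I * z * φ z) ξ := by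
  refine neg_eq_iff_eq_neg.1 (Eq.symm ?_)
  exact integral_mul_deriv_eq_deriv_mul_of_integrable (fun t _ => hd t)
    (fun t _ => hφ.hasDerivAt_invFourierLine t)
    (hf.integrable_mul (hφ.mul contDiffOn_I_mul)) (hf'.integrable_mul hφ) (hf.integrable_mul hφ)

lemma deriv_left {f' : ℝ → ℂ} (hd : ∀ t, HasDerivAt f (f' t) t)
    (hf : PolyGrowth f) (hf' : PolyGrowth f') (h : RepOffZero f K) :
    RepOffZero f' (fun z : ℝ => -Complex.I * z * K z) := by
  intro φ hφ
  rw [integral_deriv_mul_invFourierLine hd hf hf' hφ, h _ (hφ.mul contDiffOn_I_mul),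
    ← integral_neg]
  congr! 2 with z
  ring

lemma of_deriv {f' : ℝ → ℂ} (hd : ∀ t, HasDerivAt f (f' t) t)
    (hf : PolyGrowth f) (hf' : PolyGrowth f') (h : RepOffZero f' K) :
    RepOffZero f (fun z : ℝ => (-Complex.I * z)⁻¹ * K z) := by
  intro φ hφ
  have hinv : ContDiffOn ℝ ∞ (fun z : ℝ => (-Complex.I * z)⁻¹) {0}ᶜ := by
    refine ContDiffOn.inv (contDiff_const.mul Complex.ofRealCLM.contDiff).contDiffOn ?_
    intro z hz
    simpa using hz
  have hcancel : (fun z : ℝ => Complex.I * z * ((-Complex.I * z)⁻¹ * φ z)) =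
      fun z => (-1) * φ z := by
    funext z
    by_cases hz : z = 0
    · simp [hz, hφ.apply_zero]
    · have hz' : (z : ℂ) ≠ 0 := by exact_mod_cast hz
      field_simp [Complex.I_ne_zero]
  have hparts := integral_deriv_mul_invFourierLine hd hf hf' (hφ.mul hinv)
  rw [hcancel, h _ (hφ.mul hinv)] at hparts
  simp only [invFourierLine_const_mul] at hparts
  simp only [neg_mul, one_mul, mul_neg, integral_neg, neg_neg] at hparts
  rw [← hparts]
  congr! 2 with z
  simp only [neg_mul]
  ring

lemma eqOn (hK : ContinuousOn K {0}ᶜ) (hL : ContinuousOn L {0}ᶜ) (h : RepOffZero f K)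
    (h' : RepOffZero f L) : Set.EqOn K L {0}ᶜ := by
  have hsub : ContinuousOn (fun z => K z - L z) {0}ᶜ := hK.sub hL
  have horthogonal (g : ℝ → ℝ) (hg : ContDiff ℝ ∞ g) (hgc : HasCompactSupport g)
      (hg0 : tsupport g ⊆ {0}ᶜ) : ∫ z, g z • (K z - L z) = 0 := by
    have hsupp : tsupport (fun z => (g z : ℂ)) ⊆ tsupport g :=
      closure_mono fun z hz => by simpa using hz
    have hφ : IsTestOffZero fun z => (g z : ℂ) :=
      ⟨Complex.ofRealCLM.contDiff.comp hg, hgc.comp_left (g := Complex.ofReal) (by simp),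
        hsupp.trans hg0⟩
    simp only [Complex.real_smul, mul_comm ((g _ : ℂ)), sub_mul]
    rw [integral_sub (hφ.integrable_mul hK) (hφ.integrable_mul hL), ← h _ hφ, ← h' _ hφ, sub_self]
  have hae := IsOpen.ae_eq_zero_of_integral_contDiff_smul_eq_zero (μ := volume)
    isOpen_compl_singleton (hsub.locallyIntegrableOn isOpen_compl_singleton.measurableSet)
    horthogonal
  rw [← ae_restrict_iff' isOpen_compl_singleton.measurableSet] at hae
  have hzero := Measure.eqOn_open_of_ae_eq (g := fun _ => 0) hae isOpen_compl_singleton hsub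
    continuousOn_const
  exact fun z hz => sub_eq_zero.1 (hzero hz)

end RepOffZero

end OffZero

section LineSymbol

open MeasureTheory Filter Topology

/-- `f 0` is a symbol of order `d` on the line and `f r` is its `r`-th derivative. -/
structure IsLineSymbol (d : ℝ) (f : ℕ → ℝ → ℂ) : Prop where
  hasDerivAt : ∀ r t, HasDerivAt (f r) (f (r + 1) t) t
  bound : ∀ r : ℕ, ∃ C : ℝ, ∀ t : ℝ, ‖f r t‖ ≤ C * (1 + |t|) ^ (d - r)

lemma neg_I_mul_ne_zero {z : ℝ} (hz : z ≠ 0) : -Complex.I * z ≠ 0 := by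
  simpa using hz

lemma one_add_abs_rpow_le_inv_one_add_sq {e : ℝ} (he : e ≤ -2) (t : ℝ) :
    (1 + |t|) ^ e ≤ (1 + t ^ 2)⁻¹ := by
  have hpos := abs_nonneg t
  calc (1 + |t|) ^ e ≤ (1 + |t|) ^ (-2 : ℝ) :=
        Real.rpow_le_rpow_of_exponent_le (by linarith) he
    _ = ((1 + |t|) ^ 2)⁻¹ := by rw [Real.rpow_neg (by linarith)]; norm_cast
    _ ≤ (1 + t ^ 2)⁻¹ := by
        refine inv_anti₀ (by positivity) ?_
        rw [← sq_abs]
        nlinarith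

namespace IsLineSymbol

variable {d : ℝ} {f : ℕ → ℝ → ℂ}

lemma continuous (hf : IsLineSymbol d f) (r : ℕ) : Continuous (f r) :=
  continuous_iff_continuousAt.2 fun t => (hf.hasDerivAt r t).continuousAt

lemma polyGrowth (hf : IsLineSymbol d f) (r : ℕ) : PolyGrowth (f r) := by
  obtain ⟨C, hC⟩ := hf.bound r
  refine ⟨hf.continuous r, C, ⌈d⌉₊, fun t => (hC t).trans ?_⟩
  have hC0 : 0 ≤ C := by simpa using (norm_nonneg _).trans (hC 0)
  rw [← Real.rpow_natCast]
  gcongr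
  · linarith [abs_nonneg t]
  · linarith [Nat.le_ceil d, r.cast_nonneg (α := ℝ)]

lemma integrable_pow_mul (hf : IsLineSymbol d f) {r m : ℕ} (h : d - r + m ≤ -2) :
    Integrable fun t : ℝ => (t : ℂ) ^ m * f r t := by
  obtain ⟨C, hC⟩ := hf.bound r
  have hC0 : 0 ≤ C := by simpa using (norm_nonneg _).trans (hC 0)
  refine integrable_of_norm_le_inv_one_add_sq (C := C)
    ((by fun_prop : Continuous fun t : ℝ => (t : ℂ) ^ m).mul
      (hf.continuous r)).aestronglyMeasurable (Eventually.of_forall fun t => ?_)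
  calc ‖(t : ℂ) ^ m * f r t‖ = |t| ^ m * ‖f r t‖ := by
        rw [norm_mul, norm_pow, Complex.norm_real, Real.norm_eq_abs]
    _ ≤ (1 + |t|) ^ m * (C * (1 + |t|) ^ (d - r)) := by
        gcongr
        · linarith
        · exact hC t
    _ = C * (1 + |t|) ^ (d - r + m) := by
        rw [Real.rpow_add (by positivity), Real.rpow_natCast]
        ring
    _ ≤ C * (1 + t ^ 2)⁻¹ := by
        gcongr
        exact one_add_abs_rpow_le_inv_one_add_sq h t

lemma integrable (hf : IsLineSymbol d f) {r : ℕ} (h : d - r ≤ -2) : Integrable (f r) := by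
  simpa using hf.integrable_pow_mul (m := 0) (by simpa using h)

lemma invFourierLine_add (hf : IsLineSymbol d f) {r : ℕ} (h : d - r ≤ -2) (n : ℕ) (z : ℝ) :
    invFourierLine (f (r + n)) z = (-Complex.I * z) ^ n * invFourierLine (f r) z := by
  have horder (k : ℕ) : d - ((r + k : ℕ) : ℝ) ≤ -2 := by
    push_cast
    linarith [k.cast_nonneg (α := ℝ)]
  induction n with
  | zero => simp
  | succ n ih =>
    rw [pow_succ', mul_assoc, ← ih]
    exact invFourierLine_deriv (hf.hasDerivAt (r + n)) (hf.integrable (horder n))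
      (hf.integrable (horder (n + 1))) z

lemma contDiff_invFourierLine (hf : IsLineSymbol d f) {r m : ℕ} (h : d - r + m ≤ -2) :
    ContDiff ℝ m (invFourierLine (f r)) := by
  have hscaled : invFourierLine (f r) = fun ξ => ((2 * Real.pi : ℝ) : ℂ)⁻¹ *
      FourierTransform.fourier (f r) (-ξ / (2 * Real.pi)) := by
    funext ξ
    rw [invFourierLine_eq_lineFourier, lineFourier_eq_fourier]
  rw [hscaled]
  refine contDiff_const.mul (ContDiff.comp (g := FourierTransform.fourier (f r)) ?_ (by fun_prop))
  refine Real.contDiff_fourier (N := m) fun n hn => ?_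
  have hnm : (n : ℝ) ≤ m := by exact_mod_cast hn
  simpa using (hf.integrable_pow_mul (r := r) (m := n) (by linarith)).norm

lemma repOffZero_of_add (hf : IsLineSymbol d f) (n r : ℕ) {L : ℝ → ℂ}
    (h : RepOffZero (f (r + n)) L) :
    RepOffZero (f r) fun z : ℝ => ((-Complex.I * z) ^ n)⁻¹ * L z := by
  induction n generalizing L with
  | zero => simpa using h
  | succ n ih =>
    convert ih (RepOffZero.of_deriv (hf.hasDerivAt (r + n)) (hf.polyGrowth _)
      (hf.polyGrowth _) h) using 2 with z
    rw [pow_succ, mul_inv, mul_assoc]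

lemma repOffZero_add (hf : IsLineSymbol d f) (n r : ℕ) {L : ℝ → ℂ}
    (h : RepOffZero (f r) L) :
    RepOffZero (f (r + n)) fun z : ℝ => (-Complex.I * z) ^ n * L z := by
  induction n with
  | zero => simpa using h
  | succ n ih =>
    simpa only [← mul_assoc, ← pow_succ', add_assoc] using
      RepOffZero.deriv_left (hf.hasDerivAt (r + n)) (hf.polyGrowth _) (hf.polyGrowth _) ih

lemma contDiffOn_inv_pow_mul_invFourierLine (hf : IsLineSymbol d f) {N : ℕ} (h : d - N ≤ -2) :
    ContDiffOn ℝ ∞ (fun z : ℝ => ((-Complex.I * z) ^ N)⁻¹ * invFourierLine (f N) z) {0}ᶜ := by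
  refine contDiffOn_infty.2 fun m => ?_
  have hsmooth : ContDiffOn ℝ m (fun z : ℝ => ((-Complex.I * z) ^ (N + m))⁻¹ *
      invFourierLine (f (N + m)) z) {0}ᶜ := by
    refine ContDiffOn.mul (ContDiffOn.inv ?_ fun z hz => pow_ne_zero _ (neg_I_mul_ne_zero hz))
      (hf.contDiff_invFourierLine (by push_cast; linarith)).contDiffOn
    exact ((contDiff_const.mul Complex.ofRealCLM.contDiff).pow _).contDiffOn
  refine hsmooth.congr fun z hz => ?_
  rw [hf.invFourierLine_add h, pow_add, mul_inv, mul_assoc,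
    inv_mul_cancel_left₀ (pow_ne_zero _ (neg_I_mul_ne_zero hz))]

theorem exists_isInvFourierOffZero (hf : IsLineSymbol d f) :
    ∃ K : ℝ → ℂ, IsInvFourierOffZero (f 0) K := by
  obtain ⟨N, hN⟩ : ∃ N : ℕ, d + 2 ≤ N := exists_nat_ge _
  have horder : d - N ≤ -2 := by linarith
  refine ⟨_, isInvFourierOffZero_iff.2 ⟨hf.contDiffOn_inv_pow_mul_invFourierLine horder, ?_⟩⟩
  refine hf.repOffZero_of_add N 0 ?_
  rw [zero_add]
  exact RepOffZero.of_integrable (hf.integrable horder)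

end IsLineSymbol

section Iterated

variable {f K : ℝ → ℂ}

lemma contDiffOn_iteratedDeriv_compl_zero (hK : ContDiffOn ℝ ∞ K {0}ᶜ) (m : ℕ) :
    ContDiffOn ℝ ∞ (iteratedDeriv m K) {0}ᶜ := by
  induction m with
  | zero => simpa using hK
  | succ m ih =>
    rw [iteratedDeriv_succ]
    exact ((contDiffOn_infty_iff_deriv_of_isOpen isOpen_compl_singleton).1 ih).2

lemma hasDerivAt_iteratedDeriv_of_ne_zero (hK : ContDiffOn ℝ ∞ K {0}ᶜ) (m : ℕ) {z : ℝ}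
    (hz : z ≠ 0) : HasDerivAt (iteratedDeriv m K) (iteratedDeriv (m + 1) K z) z := by
  rw [iteratedDeriv_succ]
  exact (((contDiffOn_iteratedDeriv_compl_zero hK m).differentiableOn (by simp) z
    hz).differentiableAt (isOpen_compl_singleton.mem_nhds hz)).hasDerivAt

lemma iteratedDeriv_id_mul (hK : ContDiffOn ℝ ∞ K {0}ᶜ) (m : ℕ) {z : ℝ} (hz : z ≠ 0) :
    iteratedDeriv m (fun z : ℝ => (z : ℂ) * K z) z =
      z * iteratedDeriv m K z + m * iteratedDeriv (m - 1) K z := by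
  induction m generalizing z with
  | zero => simp
  | succ m ih =>
    have hnhds : iteratedDeriv m (fun z : ℝ => (z : ℂ) * K z) =ᶠ[𝓝 z] fun z : ℝ =>
        z * iteratedDeriv m K z + m * iteratedDeriv (m - 1) K z := by
      filter_upwards [isOpen_compl_singleton.mem_nhds hz] with y hy using ih hy
    have hid : HasDerivAt (fun y : ℝ => (y : ℂ)) 1 z := Complex.ofRealCLM.hasDerivAt
    have hprod := (hid.mul (hasDerivAt_iteratedDeriv_of_ne_zero hK m hz)).add
      ((hasDerivAt_iteratedDeriv_of_ne_zero hK (m - 1) hz).const_mul (m : ℂ))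
    rw [iteratedDeriv_succ, hnhds.deriv_eq, Nat.add_sub_cancel]
    refine hprod.deriv.trans ?_
    rcases m with _ | m
    · simp [add_comm]
    · push_cast [Nat.add_sub_cancel]
      ring

lemma RepOffZero.pow_mul (hK : ContDiffOn ℝ ∞ K {0}ᶜ) (h : RepOffZero f K) (m : ℕ) :
    RepOffZero (fun t : ℝ => (t : ℂ) ^ m * f t)
      (fun z => (-Complex.I) ^ m * iteratedDeriv m K z) := by
  have hpow : RepOffZero (fun t : ℝ => (Complex.I * t) ^ m * f t) (iteratedDeriv m K) := by
    induction m with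
    | zero => simpa using h
    | succ m ih =>
      rw [iteratedDeriv_succ]
      simpa only [pow_succ', mul_assoc] using ih.id_mul (contDiffOn_iteratedDeriv_compl_zero hK m)
  convert hpow.const_mul ((-Complex.I) ^ m) using 2 with t
  rw [← mul_assoc, ← mul_pow, ← mul_assoc]
  simp

lemma PolyGrowth.polynomial (P : Polynomial ℂ) : PolyGrowth fun t : ℝ => P.eval (t : ℂ) := by
  simp only [P.eval_eq_sum_range]
  exact PolyGrowth.sum _ fun n _ => by simpa using (PolyGrowth.one.pow_mul n).const_mul (P.coeff n)

lemma RepOffZero.polynomial (P : Polynomial ℂ) : RepOffZero (fun t : ℝ => P.eval (t : ℂ)) 0 := by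
  induction P using Polynomial.induction_on' with
  | add P Q hP hQ =>
    convert RepOffZero.add (PolyGrowth.polynomial P) (PolyGrowth.polynomial Q)
      continuousOn_const continuousOn_const hP hQ using 1
    · simp only [Polynomial.eval_add]
    · exact funext fun _ => (add_zero 0).symm
  | monomial n a =>
    have hpow := (RepOffZero.one.pow_mul (K := 0) contDiffOn_const n).const_mul a
    simpa [Pi.zero_def, iteratedDeriv_const_zero] using hpow

end Iterated

section ResolventKernel

/-- The function `i e^{-az} 1_{z > 0}`, whose Fourier transform is `(t - ia)⁻¹`. -/
noncomputable def resolventKernel (a : ℝ) : ℝ → ℂ :=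
  (Set.Ioi 0).indicator fun z : ℝ => Complex.I * Complex.exp (-a * z)

variable {a : ℝ}

lemma norm_resolventKernel_le (ha : 0 ≤ a) (z : ℝ) : ‖resolventKernel a z‖ ≤ 1 := by
  rw [resolventKernel, norm_indicator_eq_indicator_norm]
  refine Set.indicator_le' (f := fun z : ℝ => ‖Complex.I * Complex.exp (-a * z)‖) (g := fun _ => 1)
    (fun z hz => ?_) (fun _ _ => zero_le_one) z
  simpa [Complex.norm_exp] using mul_nonneg ha (le_of_lt hz)

lemma continuousOn_resolventKernel (a : ℝ) : ContinuousOn (resolventKernel a) {0}ᶜ := by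
  have hexp : Continuous fun z : ℝ => Complex.I * Complex.exp (-a * z) := by fun_prop
  refine continuousOn_of_forall_continuousAt fun z hz => ?_
  exact hexp.continuousOn.continuousAt_indicator (by simpa [frontier_Ioi] using hz)

lemma integrable_resolventKernel (ha : 0 < a) : Integrable (resolventKernel a) :=
  (integrable_indicator_iff measurableSet_Ioi).2
    ((integrableOn_exp_mul_complex_Ioi (a := (-a : ℂ)) (by simpa using ha) 0).const_mul _)

lemma sub_I_mul_ne_zero (ha : 0 < a) (t : ℝ) : (t : ℂ) - Complex.I * a ≠ 0 := fun h =>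
  ha.ne' (by simpa using congrArg Complex.im h)

lemma lineFourier_resolventKernel (ha : 0 < a) (t : ℝ) :
    lineFourier (resolventKernel a) t = ((t : ℂ) - Complex.I * a)⁻¹ := by
  have hexp (z : ℝ) : Complex.exp (-Complex.I * z * t) * resolventKernel a z =
      (Set.Ioi 0).indicator
        (fun z : ℝ => Complex.I * Complex.exp ((-a - Complex.I * t) * z)) z := by
    rw [resolventKernel, ← Set.indicator_mul_right (Set.Ioi 0)
      fun z : ℝ => Complex.exp (-Complex.I * z * t)]
    congr! 2 with z
    rw [mul_left_comm, ← Complex.exp_add]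
    ring_nf
  have hre : ((-a : ℂ) - Complex.I * t).re < 0 := by simpa using ha
  have hne : (-a : ℂ) - Complex.I * t ≠ 0 := fun h => by simp [h] at hre
  simp only [lineFourier, hexp]
  rw [integral_indicator measurableSet_Ioi, integral_const_mul, integral_exp_mul_complex_Ioi hre]
  simp only [Complex.ofReal_zero, mul_zero, Complex.exp_zero]
  rw [← mul_eq_one_iff_eq_inv₀ (sub_I_mul_ne_zero ha t), mul_div_assoc', div_mul_eq_mul_div,
    div_eq_one_iff_eq hne]
  linear_combination (a : ℂ) * Complex.I_mul_I

lemma integrable_poisson (ha : 0 < a) : Integrable fun t : ℝ => a / (a ^ 2 + t ^ 2) := by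
  refine ((integrable_inv_one_add_sq.comp_div ha.ne').const_mul a⁻¹).congr
    (Eventually.of_forall fun _ => ?_)
  field_simp

lemma integral_poisson (ha : 0 < a) : ∫ t : ℝ, a / (a ^ 2 + t ^ 2) = Real.pi := by
  have hscale := Measure.integral_comp_div (fun t : ℝ => (1 + t ^ 2)⁻¹) a
  rw [integral_univ_inv_one_add_sq, abs_of_pos ha, smul_eq_mul] at hscale
  rw [← mul_right_inj' ha.ne', ← hscale, ← integral_const_mul]
  congr! 2
  field_simp

lemma norm_inv_sub_I_mul_le (ha : 0 < a) (t : ℝ) : ‖((t : ℂ) - Complex.I * a)⁻¹‖ ≤ a⁻¹ := by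
  rw [norm_inv]
  refine inv_anti₀ ha ?_
  simpa [abs_of_pos ha] using Complex.abs_im_le_norm ((t : ℂ) - Complex.I * a)

lemma continuous_inv_sub_I_mul (ha : 0 < a) :
    Continuous fun t : ℝ => ((t : ℂ) - Complex.I * a)⁻¹ :=
  Continuous.inv₀ (by fun_prop) (sub_I_mul_ne_zero ha)

lemma polyGrowth_inv_sub_I_mul (ha : 0 < a) :
    PolyGrowth fun t : ℝ => ((t : ℂ) - Complex.I * a)⁻¹ :=
  ⟨continuous_inv_sub_I_mul ha, a⁻¹, 0, fun t => by simpa using norm_inv_sub_I_mul_le ha t⟩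

lemma repOffZero_resolventKernel (ha : 0 < a) :
    RepOffZero (fun t : ℝ => ((t : ℂ) - Complex.I * a)⁻¹) (resolventKernel a) := by
  rw [← funext (lineFourier_resolventKernel ha)]
  exact RepOffZero.lineFourier_of_integrable (integrable_resolventKernel ha)

section Poisson

variable {Q : ℝ → ℂ} {B : ℝ}

lemma integrable_of_norm_le_poisson (ha : 0 < a) (hc : Continuous Q)
    (hQ : ∀ t, ‖Q t‖ ≤ B * (a / (a ^ 2 + t ^ 2))) : Integrable Q :=
  ((integrable_poisson ha).const_mul B).mono' hc.aestronglyMeasurable (Eventually.of_forall hQ)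

lemma norm_invFourierLine_le_of_le_poisson (ha : 0 < a)
    (hQ : ∀ t, ‖Q t‖ ≤ B * (a / (a ^ 2 + t ^ 2))) (z : ℝ) :
    ‖invFourierLine Q z‖ ≤ B * Real.pi := by
  refine (norm_invFourierLine_le Q z).trans ?_
  rw [← integral_poisson ha, ← integral_const_mul]
  exact integral_mono_of_nonneg (Eventually.of_forall fun z => norm_nonneg _)
    ((integrable_poisson ha).const_mul B) (Eventually.of_forall hQ)

lemma polyGrowth_of_norm_le_poisson (ha : 0 < a) (hc : Continuous Q)
    (hQ : ∀ t, ‖Q t‖ ≤ B * (a / (a ^ 2 + t ^ 2))) : PolyGrowth Q := by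
  have hB : 0 ≤ B := nonneg_of_mul_nonneg_left ((norm_nonneg _).trans (hQ 0)) (by positivity)
  refine ⟨hc, B * (a / a ^ 2), 0, fun t => (hQ t).trans ?_⟩
  rw [pow_zero, mul_one]
  gcongr
  exact le_add_of_nonneg_right (sq_nonneg t)

end Poisson

lemma norm_kernel_le {F K Q : ℝ → ℂ} {B : ℝ} (hK : ContinuousOn K {0}ᶜ) (h : RepOffZero F K)
    (hFc : Continuous F) (P : Polynomial ℂ) (s : ℂ) (ha : 0 < a)
    (hF : ∀ t : ℝ, F t = P.eval (t : ℂ) + s * ((t : ℂ) - Complex.I * a)⁻¹ + Q t)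
    (hQ : ∀ t, ‖Q t‖ ≤ B * (a / (a ^ 2 + t ^ 2))) {z : ℝ} (hz : z ≠ 0) :
    ‖K z‖ ≤ ‖s‖ + B * Real.pi := by
  have hres := (polyGrowth_inv_sub_I_mul ha).const_mul s
  have hQc : Continuous Q := by
    have hsub : Q = fun t : ℝ => F t - (P.eval (t : ℂ) + s * ((t : ℂ) - Complex.I * a)⁻¹) :=
      funext fun t => by rw [hF t]; ring
    rw [hsub]
    exact hFc.sub ((PolyGrowth.polynomial P).1.add hres.1)
  have hck : ContinuousOn (fun z => (0 : ℝ → ℂ) z + s * resolventKernel a z) {0}ᶜ :=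
    continuousOn_const.add (continuousOn_const.mul (continuousOn_resolventKernel a))
  have hQi := integrable_of_norm_le_poisson ha hQc hQ
  have hQk := (continuous_invFourierLine hQi).continuousOn (s := {0}ᶜ)
  have hsum := RepOffZero.add ((PolyGrowth.polynomial P).add hres)
    (polyGrowth_of_norm_le_poisson ha hQc hQ) hck hQk
    (RepOffZero.add (PolyGrowth.polynomial P) hres continuousOn_const
      (continuousOn_const.mul (continuousOn_resolventKernel a)) (RepOffZero.polynomial P)
      ((repOffZero_resolventKernel ha).const_mul s)) (RepOffZero.of_integrable hQi)
  rw [← funext hF] at hsum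
  rw [h.eqOn hK (hck.add hQk) hsum hz]
  simp only [Pi.add_apply, Pi.zero_apply, zero_add]
  refine norm_add_le_of_le ?_ (norm_invFourierLine_le_of_le_poisson ha hQ z)
  rw [norm_mul]
  exact mul_le_of_le_one_right (norm_nonneg _) (norm_resolventKernel_le ha.le z)

end ResolventKernel

end LineSymbol

section KernelBounds

open MeasureTheory Filter Topology

lemma rpow_le_of_comparable {x y c : ℝ} (hx : 0 < x) (hy : 0 < y) (hxy : x ≤ c * y)
    (hyx : y ≤ c * x) (e : ℝ) : x ^ e ≤ c ^ |e| * y ^ e := by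
  have hc : 0 < c := pos_of_mul_pos_left (hx.trans_le hxy) hy.le
  rcases le_total 0 e with he | he
  · rw [abs_of_nonneg he, ← Real.mul_rpow hc.le hy.le]
    exact Real.rpow_le_rpow hx.le hxy he
  · have h := Real.rpow_le_rpow_of_nonpos hy hyx he
    rwa [abs_of_nonpos he, Real.rpow_neg hc.le, ← div_eq_inv_mul,
      le_div_iff₀ (Real.rpow_pos_of_pos hc _), mul_comm, ← Real.mul_rpow hc.le hx.le]

section Bracket

variable {k : ℕ} (ξ : Euc k)

lemma japBracket_rpow_neg_mul_le_iff {e a C : ℝ} :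
    japBracket ξ ^ (-e) * a ≤ C ↔ a ≤ C * japBracket ξ ^ e := by
  rw [Real.rpow_neg (japBracket_pos ξ).le,
    inv_mul_le_iff₀ (Real.rpow_pos_of_pos (japBracket_pos ξ) e), mul_comm]

lemma japBracket_joinLast_le (t : ℝ) : japBracket (joinLast ξ t) ≤ japBracket ξ + |t| := by
  have hpos := japBracket_pos ξ
  refine le_of_sq_le_sq ?_ (by positivity)
  rw [japBracket_joinLast_sq, ← sq_abs t]
  nlinarith [mul_nonneg hpos.le (abs_nonneg t)]

lemma japBracket_joinLast_rpow_le (e t : ℝ) :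
    japBracket (joinLast ξ t) ^ e ≤ (2 * japBracket ξ) ^ |e| * (1 + |t|) ^ e := by
  have hone := one_le_japBracket ξ
  have ht := abs_nonneg t
  refine rpow_le_of_comparable (japBracket_pos _) (by positivity) ?_ ?_ e
  · nlinarith [japBracket_joinLast_le ξ t]
  · nlinarith [japBracket_le_japBracket_joinLast ξ t, abs_le_japBracket_joinLast ξ t]

lemma norm_sub_I_mul_japBracket (t : ℝ) :
    ‖(t : ℂ) - Complex.I * japBracket ξ‖ = japBracket (joinLast ξ t) := by
  refine (sq_eq_sq₀ (norm_nonneg _) (japBracket_pos _).le).1 ?_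
  rw [japBracket_joinLast_sq, ← Complex.normSq_eq_norm_sq, Complex.normSq_apply]
  simp
  ring

end Bracket

lemma IsSymbol.norm_le {n : ℕ} {r : ℝ} {s : Euc n × Euc n → ℂ} (hs : IsSymbol r s) :
    ∃ C : ℝ, ∀ x ξ : Euc n, ‖s (x, ξ)‖ ≤ C * japBracket ξ ^ r := by
  obtain ⟨C, hC⟩ := hs.2 0 0
  refine ⟨C, fun x ξ => (japBracket_rpow_neg_mul_le_iff ξ).1 ?_⟩
  simpa [Dx, Dxi, multiD_zero, multiLength] using hC x ξ

variable {k : ℕ} {d : ℝ} {p : Euc (k + 1) × Euc (k + 1) → ℂ}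

namespace IsSymbol

lemma isLineSymbol_normalSlice (hp : IsSymbol d p) (α β : Fin (k + 1) → ℕ) (x ξ : Euc k) :
    IsLineSymbol (d - multiLength α) (fun r t =>
      Complex.I ^ r * normalSlice p (α + Pi.single (Fin.last k) r) β x ξ t) where
  hasDerivAt r t := by
    refine ((hasDerivAt_normalSlice hp.1 _ β x ξ t).const_mul _).congr_deriv ?_
    rw [add_assoc, ← Pi.single_add, pow_succ, mul_assoc]
  bound r := by
    obtain ⟨C, hC0, hC⟩ := hp.norm_normalSlice_le (α + Pi.single (Fin.last k) r) β
    refine ⟨C * (2 * japBracket ξ) ^ |d - multiLength α - r|, fun t => ?_⟩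
    rw [norm_mul, norm_pow, Complex.norm_I, one_pow, one_mul, mul_assoc]
    refine (hC x ξ t).trans ?_
    rw [multiLength_add, multiLength_single, Nat.cast_add, ← sub_sub]
    gcongr
    exact japBracket_joinLast_rpow_le _ _ _

lemma exists_isInvFourierOffZero (hp : IsSymbol d p) (α β : Fin (k + 1) → ℕ)
    (x ξ : Euc k) : ∃ K : ℝ → ℂ, IsInvFourierOffZero (normalSlice p α β x ξ) K := by
  simpa using (hp.isLineSymbol_normalSlice α β x ξ).exists_isInvFourierOffZero

lemma polyGrowth_normalSlice (hp : IsSymbol d p) (α β : Fin (k + 1) → ℕ)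
    (x ξ : Euc k) : PolyGrowth (normalSlice p α β x ξ) := by
  simpa using (hp.isLineSymbol_normalSlice α β x ξ).polyGrowth 0

lemma isInvFourierOffZero_add_single (hp : IsSymbol d p) {α β : Fin (k + 1) → ℕ}
    {x ξ : Euc k} {K : ℝ → ℂ} (hK : IsInvFourierOffZero (normalSlice p α β x ξ) K) :
    IsInvFourierOffZero (normalSlice p (α + Pi.single (Fin.last k) 1) β x ξ)
      (fun z : ℝ => -1 * (z * K z)) := by
  rw [isInvFourierOffZero_iff] at hK ⊢
  refine ⟨contDiffOn_const.mul (Complex.ofRealCLM.contDiff.contDiffOn.mul hK.1), ?_⟩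
  have hderiv := RepOffZero.deriv_left (fun t => hasDerivAt_normalSlice hp.1 α β x ξ t)
    (hp.polyGrowth_normalSlice α β x ξ)
    ((hp.polyGrowth_normalSlice (α + Pi.single (Fin.last k) 1) β x ξ).const_mul Complex.I) hK.2
  convert hderiv.const_mul (-Complex.I) using 2 with t z
  · simp [← mul_assoc]
  · linear_combination (-(z : ℂ) * K z) * Complex.I_mul_I

end IsSymbol

/-- The remainder of `t ^ m * f t` after subtraction of the polynomial part
`∑ c_j t ^ (j + m)`, `-m ≤ j ≤ M`, of the Laurent series with coefficients `c`. -/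
noncomputable def laurentRemainder (M : ℤ) (f : ℝ → ℂ) (c : ℤ → ℂ) (m : ℕ) (t : ℝ) : ℂ :=
  (t : ℂ) ^ m * f t - ∑ j ∈ Finset.Icc (-(m : ℤ)) M, c j * (t : ℂ) ^ (j + m)

section LaurentRemainder

variable (M : ℤ) (f : ℝ → ℂ) (c : ℤ → ℂ) (m : ℕ)

lemma laurentRemainder_succ (t : ℝ) :
    laurentRemainder M f c (m + 1) t = t * laurentRemainder M f c m t -
      if -((m + 1 : ℕ) : ℤ) ≤ M then c (-((m + 1 : ℕ) : ℤ)) else 0 := by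
  have hzpow (j : ℤ) (hj : j ∈ Finset.Icc (-(m : ℤ)) M) :
      c j * (t : ℂ) ^ (j + ((m + 1 : ℕ) : ℤ)) = t * (c j * (t : ℂ) ^ (j + m)) := by
    obtain ⟨n, hn⟩ := Int.eq_ofNat_of_zero_le (show 0 ≤ j + m by
      linarith [(Finset.mem_Icc.1 hj).1])
    rw [show j + ((m + 1 : ℕ) : ℤ) = ((n + 1 : ℕ) : ℤ) by push_cast; linarith, hn, zpow_natCast,
      zpow_natCast, pow_succ']
    ring
  simp only [laurentRemainder, mul_sub, Finset.mul_sum, ← Finset.sum_congr rfl hzpow]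
  split_ifs with hm
  · rw [← Finset.insert_Icc_add_one_left_eq_Icc hm, Finset.sum_insert (by simp),
      show -((m + 1 : ℕ) : ℤ) + 1 = -(m : ℤ) by push_cast; ring]
    simp
    ring
  · rw [Finset.Icc_eq_empty hm, Finset.Icc_eq_empty (by push_cast at hm; omega)]
    simp
    ring

lemma exists_polynomial_laurentRemainder : ∃ P : Polynomial ℂ, ∀ t : ℝ,
    laurentRemainder M f c m t = (t : ℂ) ^ m * f t - P.eval (t : ℂ) := by
  refine ⟨∑ j ∈ Finset.Icc (-(m : ℤ)) M, Polynomial.C (c j) * Polynomial.X ^ (j + m).toNat,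
    fun t => ?_⟩
  rw [laurentRemainder, Polynomial.eval_finsetSum]
  congr 1
  refine Finset.sum_congr rfl fun j hj => ?_
  have hj : 0 ≤ j + m := by linarith [(Finset.mem_Icc.1 hj).1]
  simp [← zpow_natCast, Int.toNat_of_nonneg hj]

end LaurentRemainder

/- `r - s / (t - ia) = ((t r - s) - i a r) / (t - ia)`: subtracting the resolvent gains the factor
that makes the remainder integrable. -/
lemma norm_sub_resolvent_le {r s : ℂ} {a t A B : ℝ} (ha : 0 < a)
    (hr : ‖r‖ ≤ A * ‖(t : ℂ) - Complex.I * a‖⁻¹)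
    (htr : ‖t * r - s‖ ≤ B * a * ‖(t : ℂ) - Complex.I * a‖⁻¹) :
    ‖r - s * ((t : ℂ) - Complex.I * a)⁻¹‖ ≤ (A + B) * (a / (a ^ 2 + t ^ 2)) := by
  have hne := sub_I_mul_ne_zero ha t
  have hsq : a ^ 2 + t ^ 2 = ‖(t : ℂ) - Complex.I * a‖ ^ 2 := by
    rw [← Complex.normSq_eq_norm_sq, Complex.normSq_apply]
    simp
    ring
  have hsplit : r - s * ((t : ℂ) - Complex.I * a)⁻¹ =
      (t * r - s - Complex.I * a * r) * ((t : ℂ) - Complex.I * a)⁻¹ := by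
    field_simp
    ring
  have hnumerator : ‖t * r - s - Complex.I * a * r‖ ≤
      (A + B) * a * ‖(t : ℂ) - Complex.I * a‖⁻¹ := by
    have hIr : ‖Complex.I * a * r‖ = a * ‖r‖ := by
      rw [norm_mul, norm_mul, Complex.norm_I, one_mul, Complex.norm_real,
        Real.norm_of_nonneg ha.le]
    calc ‖t * r - s - Complex.I * a * r‖ ≤ ‖t * r - s‖ + a * ‖r‖ := hIr ▸ norm_sub_le _ _
      _ ≤ B * a * ‖(t : ℂ) - Complex.I * a‖⁻¹ + a * (A * ‖(t : ℂ) - Complex.I * a‖⁻¹) := by gcongr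
      _ = (A + B) * a * ‖(t : ℂ) - Complex.I * a‖⁻¹ := by ring
  rw [hsplit, norm_mul, norm_inv, hsq]
  refine (mul_le_mul_of_nonneg_right hnumerator (by positivity)).trans_eq ?_
  ring

lemma norm_iteratedDeriv_kernel_le (hp : IsSymbol d p) {α β : Fin (k + 1) → ℕ}
    {s : ℤ → Euc k × Euc k → ℂ} (hs : IsNormalExpansion d p α β s) (m : ℕ) :
    ∃ C : ℝ, ∀ (x ξ : Euc k) (K : ℝ → ℂ), IsInvFourierOffZero (normalSlice p α β x ξ) K →
      ∀ z : ℝ, z ≠ 0 →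
        ‖iteratedDeriv m K z‖ ≤ C * japBracket ξ ^ (d + 1 - multiLength α + m) := by
  set M : ℤ := ⌊d - multiLength α⌋
  set E : ℝ := d + 1 - multiLength α + m with hE
  obtain ⟨A, hA⟩ := hs.2 m
  obtain ⟨B, hB⟩ := hs.2 (m + 1)
  obtain ⟨S, hS⟩ : ∃ S : ℝ, ∀ x ξ, ‖if -((m + 1 : ℕ) : ℤ) ≤ M then
      s (-((m + 1 : ℕ) : ℤ)) (x, ξ) else 0‖ ≤ S * japBracket ξ ^ E := by
    split_ifs with hm
    · convert (hs.1 (-((m + 1 : ℕ) : ℤ)) (Int.le_floor.1 hm)).norm_le using 7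
      push_cast
      ring
    · exact ⟨0, by simp⟩
  refine ⟨S + (A + B) * Real.pi, fun x ξ K hK z hz => ?_⟩
  have ha := japBracket_pos ξ
  rw [isInvFourierOffZero_iff] at hK
  obtain ⟨P, hP⟩ := exists_polynomial_laurentRemainder M (normalSlice p α β x ξ) (s · (x, ξ)) m
  set σ : ℂ := if -((m + 1 : ℕ) : ℤ) ≤ M then s (-((m + 1 : ℕ) : ℤ)) (x, ξ) else 0 with hσ
  have hQ (t : ℝ) : ‖laurentRemainder M (normalSlice p α β x ξ) (s · (x, ξ)) m t
      - σ * ((t : ℂ) - Complex.I * japBracket ξ)⁻¹‖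
      ≤ (A * japBracket ξ ^ E + B * japBracket ξ ^ E)
        * (japBracket ξ / (japBracket ξ ^ 2 + t ^ 2)) := by
    refine norm_sub_resolvent_le ha ?_ ?_
    · rw [norm_sub_I_mul_japBracket]
      exact hA x ξ t
    · rw [hσ, ← laurentRemainder_succ M (normalSlice p α β x ξ) (s · (x, ξ)) m t,
        norm_sub_I_mul_japBracket, mul_assoc B, ← Real.rpow_add_one ha.ne', hE, add_assoc (_ - _),
        ← Nat.cast_succ]
      exact hB x ξ t
  have hbound := norm_kernel_le (F := fun t : ℝ => (t : ℂ) ^ m * normalSlice p α β x ξ t)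
    (B := (A + B) * japBracket ξ ^ E)
    (continuousOn_const.mul (contDiffOn_iteratedDeriv_compl_zero hK.1 m).continuousOn)
    (hK.2.pow_mul hK.1 m) ((hp.polyGrowth_normalSlice α β x ξ).pow_mul m).1 P σ ha
    (fun t => by rw [← sub_eq_iff_eq_add', ← sub_sub, ← hP t, laurentRemainder])
    (fun t => (hQ t).trans_eq (by ring)) hz
  replace hbound : ‖iteratedDeriv m K z‖ ≤ ‖σ‖ + (A + B) * japBracket ξ ^ E * Real.pi := by
    simpa using hbound
  calc ‖iteratedDeriv m K z‖ ≤ S * japBracket ξ ^ E + (A + B) * japBracket ξ ^ E * Real.pi :=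
        hbound.trans (add_le_add_left (hS x ξ) _)
    _ = (S + (A + B) * Real.pi) * japBracket ξ ^ E := by ring

lemma norm_weighted_kernel_le (hp : IsSymbol d p)
    (hs : ∀ α β : Fin (k + 1) → ℕ, ∃ s : ℤ → Euc k × Euc k → ℂ, IsNormalExpansion d p α β s)
    (l : ℕ) (α β : Fin (k + 1) → ℕ) (m : ℕ) :
    ∃ C : ℝ, ∀ (x ξ : Euc k) (K : ℝ → ℂ), IsInvFourierOffZero (normalSlice p α β x ξ) K →
      ∀ z : ℝ, z ≠ 0 →
        ‖(z : ℂ) ^ l * iteratedDeriv m K z‖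
          ≤ C * japBracket ξ ^ (d + 1 - multiLength α - l + m) := by
  induction l generalizing α m with
  | zero =>
    obtain ⟨s, hs⟩ := hs α β
    obtain ⟨C, hC⟩ := norm_iteratedDeriv_kernel_le hp hs m
    exact ⟨C, fun x ξ K hK z hz => by simpa using hC x ξ K hK z hz⟩
  | succ l ih =>
    obtain ⟨A, hA⟩ := ih (α + Pi.single (Fin.last k) 1) m
    obtain ⟨B, hB⟩ := ih α (m - 1)
    refine ⟨A + m * B, fun x ξ K hK z hz => ?_⟩
    have hA' := hA x ξ _ (hp.isInvFourierOffZero_add_single hK) z hz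
    rw [iteratedDeriv_const_mul_field, iteratedDeriv_id_mul (isInvFourierOffZero_iff.1 hK).1 m hz,
      multiLength_add, multiLength_single] at hA'
    have hsplit : (z : ℂ) ^ (l + 1) * iteratedDeriv m K z =
        -((z : ℂ) ^ l * (-1 * (z * iteratedDeriv m K z + m * iteratedDeriv (m - 1) K z)))
          - m * ((z : ℂ) ^ l * iteratedDeriv (m - 1) K z) := by ring
    rw [hsplit, add_mul]
    refine norm_sub_le_of_le ?_ ?_
    · rw [norm_neg]
      refine hA'.trans_eq ?_
      congr 2
      push_cast
      ring
    · rw [norm_mul, Complex.norm_natCast, mul_assoc]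
      rcases m with _ | m
      · simp
      · refine mul_le_mul_of_nonneg_left ((hB x ξ K hK z hz).trans_eq ?_) (by positivity)
        congr 2
        push_cast [Nat.add_sub_cancel]
        ring

theorem hasWeightedKernelBounds_of_expansion (hp : IsSymbol d p)
    (hs : ∀ α β : Fin (k + 1) → ℕ, ∃ s : ℤ → Euc k × Euc k → ℂ, IsNormalExpansion d p α β s) :
    HasWeightedKernelBounds d p := by
  intro α β l m
  obtain ⟨C, hC⟩ := norm_weighted_kernel_le hp hs l α β m
  refine ⟨C, fun x ξ => ?_⟩
  obtain ⟨K, hK⟩ := hp.exists_isInvFourierOffZero α β x ξ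
  refine ⟨K, hK, fun z hz => (japBracket_rpow_neg_mul_le_iff ξ).2 ?_⟩
  simpa [weightedD] using hC x ξ K hK z hz

theorem HasWeightedKernelBounds.isSymbolUTTR (hp : IsSymbol d p)
    (h : HasWeightedKernelBounds d p) : IsSymbolUTTR d p := by
  refine ⟨hp, fun α β l m ξ => ?_⟩
  obtain ⟨C, hC⟩ := h α β l m
  refine ⟨C * japBracket ξ ^ (d + 1 - multiLength α - l + m), fun x => ?_⟩
  obtain ⟨K, hK, hbound⟩ := hC x ξ
  exact ⟨K, hK, fun z hz => (japBracket_rpow_neg_mul_le_iff ξ).1 (hbound z hz)⟩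

end KernelBounds

section Taylor

lemma hasDerivAt_sum_pow_div_factorial (a : ℕ → ℂ) (N : ℕ) (τ : ℝ) :
    HasDerivAt (fun τ : ℝ => ∑ r ∈ Finset.range (N + 1), a r * ((τ : ℂ) ^ r / r.factorial))
      (∑ r ∈ Finset.range N, a (r + 1) * ((τ : ℂ) ^ r / r.factorial)) τ := by
  simp only [Finset.sum_range_succ', pow_zero]
  refine (HasDerivAt.fun_sum fun r _ => HasDerivAt.const_mul _ ?_).add_const _
  have hid : HasDerivAt (fun y : ℝ => (y : ℂ)) 1 τ := Complex.ofRealCLM.hasDerivAt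
  refine ((hid.pow (r + 1)).div_const _).congr_deriv ?_
  have hfactorial : (r.factorial : ℂ) ≠ 0 := by exact_mod_cast r.factorial_ne_zero
  have hsucc : (r : ℂ) + 1 ≠ 0 := by exact_mod_cast r.succ_ne_zero
  rw [Nat.factorial_succ]
  push_cast
  field_simp

lemma norm_sub_taylor_le (N : ℕ) {φ : ℕ → ℝ → ℂ} (hφ : ∀ r τ, HasDerivAt (φ r) (φ (r + 1) τ) τ)
    {M : ℝ} (hM : ∀ τ ∈ Set.Icc (0 : ℝ) 1, ‖φ N τ‖ ≤ M) :
    ∀ τ ∈ Set.Icc (0 : ℝ) 1,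
      ‖φ 0 τ - ∑ r ∈ Finset.range N, φ r 0 * ((τ : ℂ) ^ r / r.factorial)‖ ≤ M := by
  induction N generalizing φ with
  | zero => simpa using hM
  | succ N ih =>
    intro τ hτ
    have hmvt := (convex_Icc 0 1).norm_image_sub_le_of_norm_hasDerivWithin_le
      (fun τ _ => ((hφ 0 τ).sub
        (hasDerivAt_sum_pow_div_factorial (φ · 0) N τ)).hasDerivWithinAt)
      (ih (φ := fun r => φ (r + 1)) (fun r τ => hφ (r + 1) τ) hM)
      (Set.left_mem_Icc.2 zero_le_one) hτ
    have hzero : φ 0 0 -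
        ∑ r ∈ Finset.range (N + 1), φ r 0 * (((0 : ℝ) : ℂ) ^ r / r.factorial) = 0 := by
      simp [Finset.sum_range_succ']
    simp only [Pi.sub_apply] at hmvt
    rw [hzero, sub_zero, sub_zero, Real.norm_of_nonneg hτ.1] at hmvt
    exact hmvt.trans (mul_le_of_le_one_right ((norm_nonneg _).trans (hM τ hτ)) hτ.2)

lemma eq_taylor_of_deriv_eq_zero {N : ℕ} {h : ℕ → ℝ → ℂ}
    (hd : ∀ r τ, HasDerivAt (h r) (h (r + 1) τ) τ) (h0 : ∀ t, h N t = 0) (t : ℝ) :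
    h 0 t = ∑ r ∈ Finset.range N, h r 0 / r.factorial * (t : ℂ) ^ r := by
  have hscaled (r : ℕ) (τ : ℝ) : HasDerivAt (fun τ => (t : ℂ) ^ r * h r (τ * t))
      ((t : ℂ) ^ (r + 1) * h (r + 1) (τ * t)) τ := by
    refine (((hd r (τ * t)).scomp τ (hasDerivAt_mul_const t)).const_mul
      ((t : ℂ) ^ r)).congr_deriv ?_
    rw [Complex.real_smul, pow_succ, mul_assoc]
  have htaylor := norm_sub_taylor_le N (M := 0) hscaled (fun τ _ => by simp [h0]) 1
    (Set.right_mem_Icc.2 zero_le_one)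
  rw [norm_le_zero_iff, sub_eq_zero] at htaylor
  simp only [pow_zero, one_mul, zero_mul] at htaylor
  rw [htaylor]
  refine Finset.sum_congr rfl fun r _ => ?_
  simp
  ring

end Taylor

section RapidDecay

open MeasureTheory Filter Topology

variable {X : Type*} {K : X → ℝ → ℂ}

/-- A family of functions on the line that are smooth off `0` and rapidly decreasing there with all
their derivatives, uniformly in the parameter; jumps at `0` are allowed. -/
structure IsRapidOffZero (K : X → ℝ → ℂ) : Prop where
  contDiffOn : ∀ x, ContDiffOn ℝ ∞ (K x) {0}ᶜ
  bound : ∀ l m : ℕ, ∃ C : ℝ, ∀ x, ∀ z : ℝ, z ≠ 0 →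
    ‖(z : ℂ) ^ l * iteratedDeriv m (K x) z‖ ≤ C

lemma ae_ne_zero : ∀ᵐ z : ℝ, z ≠ 0 := by
  simp [ae_iff]

lemma aestronglyMeasurable_of_continuousOn_compl_zero {f : ℝ → ℂ} (hf : ContinuousOn f {0}ᶜ) :
    AEStronglyMeasurable f := by
  have h := hf.aestronglyMeasurable (μ := volume) isOpen_compl_singleton.measurableSet
  rwa [Measure.restrict_eq_self_of_ae_mem (by simpa using ae_ne_zero)] at h

namespace IsRapidOffZero

lemma iteratedDeriv (hK : IsRapidOffZero K) (n : ℕ) :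
    IsRapidOffZero fun x => iteratedDeriv n (K x) where
  contDiffOn x := contDiffOn_iteratedDeriv_compl_zero (hK.contDiffOn x) n
  bound l m := by
    obtain ⟨C, hC⟩ := hK.bound l (m + n)
    refine ⟨C, fun x z hz => ?_⟩
    simpa only [iteratedDeriv_eq_iterate, Function.iterate_add_apply] using hC x z hz

lemma id_mul (hK : IsRapidOffZero K) : IsRapidOffZero fun x (z : ℝ) => (z : ℂ) * K x z where
  contDiffOn x := Complex.ofRealCLM.contDiff.contDiffOn.mul (hK.contDiffOn x)
  bound l m := by
    obtain ⟨A, hA⟩ := hK.bound (l + 1) m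
    obtain ⟨B, hB⟩ := hK.bound l (m - 1)
    refine ⟨A + m * B, fun x z hz => ?_⟩
    have hsplit : (z : ℂ) ^ l * _root_.iteratedDeriv m (fun z : ℝ => (z : ℂ) * K x z) z =
        (z : ℂ) ^ (l + 1) * _root_.iteratedDeriv m (K x) z +
          m * ((z : ℂ) ^ l * _root_.iteratedDeriv (m - 1) (K x) z) := by
      rw [iteratedDeriv_id_mul (hK.contDiffOn x) m hz]
      ring
    rw [hsplit]
    refine norm_add_le_of_le (hA x z hz) ?_
    rw [norm_mul, Complex.norm_natCast]
    exact mul_le_mul_of_nonneg_left (hB x z hz) m.cast_nonneg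

lemma const_mul (hK : IsRapidOffZero K) (c : ℂ) : IsRapidOffZero fun x z => c * K x z where
  contDiffOn x := contDiffOn_const.mul (hK.contDiffOn x)
  bound l m := by
    obtain ⟨C, hC⟩ := hK.bound l m
    refine ⟨‖c‖ * C, fun x z hz => ?_⟩
    rw [iteratedDeriv_const_mul_field, mul_left_comm, norm_mul]
    exact mul_le_mul_of_nonneg_left (hC x z hz) (norm_nonneg c)

lemma pow_mul (hK : IsRapidOffZero K) (r : ℕ) :
    IsRapidOffZero fun x (z : ℝ) => (-Complex.I * z) ^ r * K x z := by
  induction r with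
  | zero => simpa using hK
  | succ r ih => simpa only [pow_succ', mul_assoc] using ih.id_mul.const_mul (-Complex.I)

lemma exists_norm_le (hK : IsRapidOffZero K) :
    ∃ B : ℝ, ∀ x, ∀ z : ℝ, z ≠ 0 → ‖K x z‖ ≤ B * (1 + z ^ 2)⁻¹ := by
  obtain ⟨C₀, h₀⟩ := hK.bound 0 0
  obtain ⟨C₂, h₂⟩ := hK.bound 2 0
  refine ⟨C₀ + C₂, fun x z hz => ?_⟩
  rw [← div_eq_mul_inv, le_div_iff₀ (by positivity), mul_add, mul_one, mul_comm _ (z ^ 2)]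
  exact add_le_add (by simpa using h₀ x z hz) (by simpa using h₂ x z hz)

lemma integrable (hK : IsRapidOffZero K) (x : X) : Integrable (K x) := by
  obtain ⟨B, hB⟩ := hK.exists_norm_le
  exact integrable_of_norm_le_inv_one_add_sq
    (aestronglyMeasurable_of_continuousOn_compl_zero (hK.contDiffOn x).continuousOn)
    (ae_ne_zero.mono fun z hz => hB x z hz)

lemma exists_integral_norm_le (hK : IsRapidOffZero K) : ∃ B : ℝ, ∀ x, ∫ z, ‖K x z‖ ≤ B := by
  obtain ⟨B, hB⟩ := hK.exists_norm_le
  exact ⟨B * Real.pi, fun x => integral_norm_le_of_le_inv_one_add_sq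
    (ae_ne_zero.mono fun z hz => hB x z hz)⟩

lemma exists_norm_lineFourier_le (hK : IsRapidOffZero K) :
    ∃ B : ℝ, ∀ x t, ‖lineFourier (K x) t‖ ≤ B :=
  hK.exists_integral_norm_le.imp fun _ hB x t => (norm_lineFourier_le _ t).trans (hB x)

lemma hasDerivAt_lineFourier (hK : IsRapidOffZero K) (r : ℕ) (x : X) (t : ℝ) :
    HasDerivAt (lineFourier fun z : ℝ => (-Complex.I * z) ^ r * K x z)
      (lineFourier (fun z : ℝ => (-Complex.I * z) ^ (r + 1) * K x z) t) t := by
  simpa only [pow_succ', mul_assoc] using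
    _root_.hasDerivAt_lineFourier ((hK.pow_mul r).integrable x)
      ((hK.pow_mul r).id_mul.integrable x) t

end IsRapidOffZero

lemma tendsto_zero_of_norm_le_inv_one_add_sq {l : Filter ℝ} {f : ℝ → ℂ} {B : ℝ}
    (hl : Tendsto (fun z : ℝ => |z|) l atTop)
    (hf : ∀ z : ℝ, z ≠ 0 → ‖f z‖ ≤ B * (1 + z ^ 2)⁻¹) : Tendsto f l (𝓝 0) := by
  have hsq : Tendsto (fun z : ℝ => 1 + z ^ 2) l atTop :=
    tendsto_atTop_add_const_left _ _
      (((tendsto_pow_atTop two_ne_zero).comp hl).congr fun z => sq_abs z)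
  refine squeeze_zero_norm' ((hl.eventually_ge_atTop 1).mono fun z hz => hf z ?_)
    (by simpa using (tendsto_inv_atTop_zero.comp hsq).const_mul B)
  rintro rfl
  norm_num at hz

lemma integral_eq_zero_of_hasDerivAt_off_zero {w w' : ℝ → ℂ} (hcont : ContinuousAt w 0)
    (hderiv : ∀ z : ℝ, z ≠ 0 → HasDerivAt w (w' z) z) (hint : Integrable w')
    (hbot : Tendsto w atBot (𝓝 0)) (htop : Tendsto w atTop (𝓝 0)) : ∫ z, w' z = 0 := by
  rw [← setIntegral_univ, ← Set.Iic_union_Ioi (a := (0 : ℝ)),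
    setIntegral_union (Set.Iic_disjoint_Ioi le_rfl) measurableSet_Ioi hint.integrableOn
      hint.integrableOn,
    integral_Ioi_of_hasDerivAt_of_tendsto hcont.continuousWithinAt
      (fun z hz => hderiv z (ne_of_gt hz)) hint.integrableOn htop,
    integral_Iic_of_hasDerivAt_of_tendsto hcont.continuousWithinAt
      (fun z hz => hderiv z (ne_of_lt hz)) hint.integrableOn hbot]
  ring

lemma continuousAt_mul_of_norm_le {e f : ℝ → ℂ} {C : ℝ} (he : ContinuousAt e 0) (he0 : e 0 = 0)
    (hf : ∀ z : ℝ, z ≠ 0 → ‖f z‖ ≤ C) : ContinuousAt (fun z => e z * f z) 0 := by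
  have hbdd : IsBoundedUnder (· ≤ ·) (𝓝[≠] 0) (norm ∘ f) :=
    isBoundedUnder_of_eventually_le (a := C) (eventually_nhdsWithin_of_forall hf)
  have hlim : Tendsto e (𝓝[≠] 0) (𝓝 0) := he0 ▸ he.tendsto.mono_left nhdsWithin_le_nhds
  rw [continuousAt_iff_punctured_nhds, he0, zero_mul]
  exact hlim.zero_mul_isBoundedUnder_le hbdd

/- The jump of `K` at `0` is removed by integrating by parts against `e^{-itz} - 1`, which vanishes
at `0`. -/
lemma IsRapidOffZero.I_mul_lineFourier (hK : IsRapidOffZero K) (x : X) (t : ℝ) :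
    Complex.I * t * lineFourier (K x) t =
      -(∫ z, deriv (K x) z) + lineFourier (deriv (K x)) t := by
  have hK' : IsRapidOffZero fun x => deriv (K x) := by
    simpa only [iteratedDeriv_one] using hK.iteratedDeriv 1
  have hderivK (z : ℝ) (hz : z ≠ 0) : HasDerivAt (K x) (deriv (K x) z) z := by
    simpa only [iteratedDeriv_zero, iteratedDeriv_one, zero_add] using
      hasDerivAt_iteratedDeriv_of_ne_zero (hK.contDiffOn x) 0 hz
  set e : ℝ → ℂ := fun z => Complex.exp (-Complex.I * z * t) with he
  have hderiv_e (z : ℝ) : HasDerivAt e (-Complex.I * t * e z) z := by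
    have hid : HasDerivAt (fun y : ℝ => (y : ℂ)) 1 z := Complex.ofRealCLM.hasDerivAt
    refine ((hid.const_mul (-Complex.I)).mul_const (t : ℂ)).cexp.congr_deriv ?_
    rw [he]
    ring
  have hnorm_e (z : ℝ) : ‖e z - 1‖ ≤ 2 :=
    (norm_sub_le _ _).trans_eq (by simp [he, Complex.norm_exp]; norm_num)
  have hint := (integrable_exp_neg_mul (hK.integrable x) t).const_mul (-Complex.I * t)
  have hint' := integrable_exp_neg_mul (hK'.integrable x) t
  obtain ⟨B, hB⟩ := hK.exists_norm_le
  have hdecay (z : ℝ) (hz : z ≠ 0) : ‖(e z - 1) * K x z‖ ≤ 2 * B * (1 + z ^ 2)⁻¹ := by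
    rw [norm_mul, mul_assoc]
    exact mul_le_mul (hnorm_e z) (hB x z hz) (norm_nonneg _) zero_le_two
  obtain ⟨C, hC⟩ := hK.bound 0 0
  have hzero := integral_eq_zero_of_hasDerivAt_off_zero
    (w' := fun z => -Complex.I * t * (e z * K x z) + (e z * deriv (K x) z - deriv (K x) z))
    (continuousAt_mul_of_norm_le ((hderiv_e 0).continuousAt.sub_const 1) (by simp [he])
      fun z hz => by simpa using hC x z hz)
    (fun z hz => (((hderiv_e z).sub_const 1).mul (hderivK z hz)).congr_deriv (by ring))
    (hint.add (hint'.sub (hK'.integrable x)))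
    (tendsto_zero_of_norm_le_inv_one_add_sq tendsto_abs_atBot_atTop hdecay)
    (tendsto_zero_of_norm_le_inv_one_add_sq tendsto_abs_atTop_atTop hdecay)
  have hsplit := integral_add hint (hint'.sub (hK'.integrable x))
  simp only [Pi.sub_apply] at hsplit
  rw [hsplit, integral_const_mul, integral_sub hint' (hK'.integrable x)] at hzero
  simp only [lineFourier]
  linear_combination -hzero

end RapidDecay

section LaurentExpansion

open Filter Topology MeasureTheory

lemma tendsto_laurentSum (c : ℤ → ℂ) {a b : ℤ} (hab : a ≤ b) :
    Tendsto (fun t : ℝ => (t : ℂ) ^ (-b) * ∑ j ∈ Finset.Icc a b, c j * (t : ℂ) ^ j) atTop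
      (𝓝 (c b)) := by
  have hterm (j : ℤ) (hj : j ∈ Finset.Icc a b) :
      Tendsto (fun t : ℝ => c j * (t : ℂ) ^ (j - b)) atTop (𝓝 (if j = b then c j else 0)) := by
    split_ifs with h
    · simp [h]
    · obtain ⟨n, hn, hn0⟩ : ∃ n : ℕ, j - b = -(n : ℤ) ∧ n ≠ 0 := by
        have := (Finset.mem_Icc.1 hj).2
        exact ⟨(b - j).toNat, by omega, by omega⟩
      have hinv : Tendsto (fun t : ℝ => (t ^ n)⁻¹) atTop (𝓝 0) :=
        tendsto_inv_atTop_zero.comp (tendsto_pow_atTop hn0)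
      simpa [hn] using hinv.ofReal.const_mul (c j)
  have hsum := tendsto_finsetSum _ hterm
  rw [Finset.sum_ite_eq' _ b, if_pos (Finset.right_mem_Icc.2 hab)] at hsum
  refine hsum.congr' ((eventually_ne_atTop 0).mono fun t ht => ?_)
  dsimp only
  rw [Finset.mul_sum]
  refine Finset.sum_congr rfl fun j _ => ?_
  rw [sub_eq_neg_add, zpow_add₀ (by exact_mod_cast ht)]
  ring

lemma coeff_eq_zero_of_growth {a b : ℤ} {c : ℤ → ℂ} {C r : ℝ}
    (h : ∀ t : ℝ, 1 ≤ t → ‖∑ j ∈ Finset.Icc a b, c j * (t : ℂ) ^ j‖ ≤ C * t ^ r) :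
    ∀ j ∈ Finset.Icc a b, r < j → c j = 0 := by
  by_contra! ⟨i, hi, hri, hci⟩
  obtain ⟨n, hn, hmax⟩ := ((Finset.Icc a b).filter fun j => c j ≠ 0).exists_max_image id
    ⟨i, Finset.mem_filter.2 ⟨hi, hci⟩⟩
  obtain ⟨hnab, hcn⟩ := Finset.mem_filter.1 hn
  obtain ⟨han, hnb⟩ := Finset.mem_Icc.1 hnab
  have hrn : r < n := hri.trans_le (by exact_mod_cast hmax i (Finset.mem_filter.2 ⟨hi, hci⟩))
  have hsum (t : ℝ) : ∑ j ∈ Finset.Icc a b, c j * (t : ℂ) ^ j =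
      ∑ j ∈ Finset.Icc a n, c j * (t : ℂ) ^ j := by
    refine (Finset.sum_subset (Finset.Icc_subset_Icc_right hnb) fun j hj hjn => ?_).symm
    by_contra hcj
    have hle : j ≤ n := hmax j (Finset.mem_filter.2 ⟨hj, left_ne_zero_of_mul hcj⟩)
    exact hjn (Finset.mem_Icc.2 ⟨(Finset.mem_Icc.1 hj).1, hle⟩)
  have hzero : Tendsto (fun t : ℝ => C * t ^ (-(n - r))) atTop (𝓝 0) := by
    simpa using (tendsto_rpow_neg_atTop (sub_pos.2 hrn)).const_mul C
  refine hcn (tendsto_nhds_unique (tendsto_laurentSum c han) (squeeze_zero_norm' ?_ hzero))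
  filter_upwards [eventually_ge_atTop 1] with t ht
  have htpos : 0 < t := one_pos.trans_le ht
  rw [← hsum, norm_mul, norm_zpow, Complex.norm_real, Real.norm_of_nonneg htpos.le]
  calc t ^ (-n) * ‖∑ j ∈ Finset.Icc a b, c j * (t : ℂ) ^ j‖
      ≤ t ^ (-n) * (C * t ^ r) := by gcongr; exact h t ht
    _ = C * t ^ (-(n - r)) := by
        rw [← Real.rpow_intCast, mul_left_comm, ← Real.rpow_add htpos]
        push_cast
        ring_nf

lemma sum_Icc_floor_eq {d e : ℝ} {F : ℤ → ℂ} (hd : ∀ j : ℤ, d < j → F j = 0)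
    (he : ∀ j : ℤ, e < j → F j = 0) (a : ℤ) :
    ∑ j ∈ Finset.Icc a ⌊d⌋, F j = ∑ j ∈ Finset.Icc a ⌊e⌋, F j := by
  have hmin {r : ℝ} (hr : ∀ j : ℤ, r < j → F j = 0) (b : ℤ) :
      ∑ j ∈ Finset.Icc a (min b ⌊r⌋), F j = ∑ j ∈ Finset.Icc a b, F j := by
    refine Finset.sum_subset (Finset.Icc_subset_Icc_right (min_le_left _ _)) fun j hj hj' => hr j ?_
    simp only [Finset.mem_Icc, le_min_iff] at hj hj'
    exact Int.floor_lt.1 (by omega)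
  rw [← hmin he, min_comm, hmin hd]

lemma sum_Icc_neg_eq {E : Type*} [AddCommMonoid E] (F : ℤ → E) (m N : ℕ) :
    ∑ j ∈ Finset.Icc (-(m : ℤ)) ((N : ℤ) - 1), F j =
      ∑ r ∈ Finset.range N, F r + ∑ i ∈ Finset.range m, F (Int.negSucc i) := by
  induction m with
  | zero =>
    induction N with
    | zero => simp
    | succ N ih =>
      rw [Finset.sum_range_succ, add_right_comm, ← ih, Nat.cast_succ, add_sub_cancel_right,
        ← Finset.insert_Icc_sub_one_right_eq_Icc (by simp), Finset.sum_insert (by simp), add_comm]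
  | succ m ih =>
    rw [Finset.sum_range_succ, ← add_assoc, ← ih,
      ← Finset.insert_Icc_add_one_left_eq_Icc (by push_cast; omega), Finset.sum_insert (by simp),
      add_comm, Int.negSucc_eq, Nat.cast_succ, neg_add, neg_add_cancel_right]

variable {X : Type*} {w : X → ℝ} {e : ℝ} {f : X → ℝ → ℂ} {c : ℤ → X → ℂ}

/-- The expansion `f x t ∼ ∑_{j ≤ e} c_j(x) t^j` in powers of `t`, uniform over the region
`w x ≤ |t|`: the coefficients and the remainders have the size expected of a function homogeneous
of degree `e` in `(w, t)`. -/
structure HasLaurentExpansion (w : X → ℝ) (e : ℝ) (f : X → ℝ → ℂ) (c : ℤ → X → ℂ) : Prop where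
  coeff_bound : ∀ j : ℤ, ∃ C : ℝ, ∀ x, ‖c j x‖ ≤ C * w x ^ (e - j)
  coeff_eq_zero : ∀ j : ℤ, e < j → ∀ x, c j x = 0
  remainder : ∀ m : ℕ, ∃ C : ℝ, ∀ x (t : ℝ), w x ≤ |t| →
    ‖f x t - ∑ j ∈ Finset.Icc (-(m : ℤ)) ⌊e⌋, c j x * (t : ℂ) ^ j‖ ≤
      C * w x ^ (e + 1 + m) / |t| ^ (m + 1)

lemma HasLaurentExpansion.of_growth {d : ℝ} (h : HasLaurentExpansion (fun _ => 1) e f c)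
    (hf : ∀ x, ∃ C : ℝ, ∀ t : ℝ, 1 ≤ t → ‖f x t‖ ≤ C * t ^ d) :
    HasLaurentExpansion (fun _ => 1) d f c := by
  have hzero (j : ℤ) (hj : d < j) (x : X) : c j x = 0 := by
    obtain ⟨A, hA⟩ := hf x
    obtain ⟨B, hB⟩ := h.remainder j.natAbs
    by_cases hje : j ≤ ⌊e⌋
    swap
    · exact h.coeff_eq_zero j (Int.floor_lt.1 (not_le.1 hje)) x
    refine coeff_eq_zero_of_growth (c := (c · x)) (a := -(j.natAbs : ℤ)) (b := ⌊e⌋) (C := |A| + |B|)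
      (r := max d (-(j.natAbs + 1 : ℕ))) (fun t ht => ?_) j (Finset.mem_Icc.2 ⟨by omega, hje⟩)
      (max_lt hj (by exact_mod_cast (by omega : -((j.natAbs + 1 : ℕ) : ℤ) < j)))
    have htpos : 0 < t := one_pos.trans_le ht
    have hrem := hB x t (by rwa [abs_of_pos htpos])
    rw [Real.one_rpow, mul_one, abs_of_pos htpos, div_eq_mul_inv, ← Real.rpow_natCast,
      ← Real.rpow_neg htpos.le] at hrem
    rw [← sub_sub_self (f x t) (∑ j ∈ _, _), add_mul]
    refine norm_sub_le_of_le ((hA t ht).trans ?_) (hrem.trans ?_)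
    · exact mul_le_mul (le_abs_self A) (Real.rpow_le_rpow_of_exponent_le ht (le_max_left _ _))
        (by positivity) (abs_nonneg A)
    · exact mul_le_mul (le_abs_self B) (Real.rpow_le_rpow_of_exponent_le ht (le_max_right _ _))
        (by positivity) (abs_nonneg B)
  refine ⟨fun j => by simpa using h.coeff_bound j, hzero, fun m => ?_⟩
  obtain ⟨C, hC⟩ := h.remainder m
  refine ⟨C, fun x t ht => ?_⟩
  rw [sum_Icc_floor_eq (fun j hj => by rw [hzero j hj, zero_mul])
    (fun j hj => by rw [h.coeff_eq_zero j hj, zero_mul])]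
  simpa using hC x t ht

/-- The coefficient of `t^{-i-1}` in the expansion of `lineFourier K` for large `t`. As
`-∫ K^{(i+1)}` is the jump of `K^{(i)}` at `0`, it is a multiple of that jump. -/
noncomputable def jumpCoeff (K : ℝ → ℂ) (i : ℕ) : ℂ :=
  (-Complex.I) ^ (i + 1) * -∫ z, iteratedDeriv (i + 1) K z

namespace IsRapidOffZero

variable {K : X → ℝ → ℂ}

lemma lineFourier_eq_sum_jumpCoeff (hK : IsRapidOffZero K) (x : X) {t : ℝ} (ht : t ≠ 0) (m : ℕ) :
    lineFourier (K x) t = ∑ i ∈ Finset.range m, jumpCoeff (K x) i * (t : ℂ) ^ Int.negSucc i +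
      (-Complex.I / t) ^ m * lineFourier (_root_.iteratedDeriv m (K x)) t := by
  have htC : (t : ℂ) ≠ 0 := by exact_mod_cast ht
  induction m with
  | zero => simp
  | succ m ih =>
    have hstep := (hK.iteratedDeriv m).I_mul_lineFourier x t
    simp only [← iteratedDeriv_succ] at hstep
    have hfactor : (-Complex.I / t) ^ m = (-Complex.I / t) ^ (m + 1) * (Complex.I * t) := by
      rw [pow_succ, mul_assoc]
      field_simp
      simp
    rw [ih, Finset.sum_range_succ, add_assoc, hfactor, mul_assoc, hstep, mul_add, jumpCoeff,
      zpow_negSucc, div_pow]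
    ring

lemma exists_norm_jumpCoeff_le (hK : IsRapidOffZero K) (i : ℕ) :
    ∃ C : ℝ, ∀ x, ‖jumpCoeff (K x) i‖ ≤ C :=
  (hK.iteratedDeriv (i + 1)).exists_integral_norm_le.imp fun _ hC x => by
    rw [jumpCoeff, norm_mul, norm_pow, norm_neg, Complex.norm_I, one_pow, one_mul, norm_neg]
    exact (norm_integral_le_integral_norm _).trans (hC x)

lemma exists_lineFourier_sub_sum_le (hK : IsRapidOffZero K) (m : ℕ) :
    ∃ C : ℝ, ∀ x (t : ℝ), 1 ≤ |t| → ‖lineFourier (K x) t -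
      ∑ i ∈ Finset.range m, jumpCoeff (K x) i * (t : ℂ) ^ Int.negSucc i‖ ≤ C / |t| ^ (m + 1) := by
  obtain ⟨A, hA⟩ := hK.exists_norm_jumpCoeff_le m
  obtain ⟨B, hB⟩ := (hK.iteratedDeriv (m + 1)).exists_norm_lineFourier_le
  refine ⟨A + B, fun x t ht => ?_⟩
  have ht0 : t ≠ 0 := by
    rintro rfl
    norm_num at ht
  rw [hK.lineFourier_eq_sum_jumpCoeff x ht0 (m + 1), Finset.sum_range_succ, add_assoc,
    add_sub_cancel_left, add_div]
  refine norm_add_le_of_le ?_ ?_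
  · rw [norm_mul, zpow_negSucc, norm_inv, norm_pow, Complex.norm_real, Real.norm_eq_abs,
      ← div_eq_mul_inv]
    gcongr
    exact hA x
  · rw [norm_mul, norm_pow, norm_div, norm_neg, Complex.norm_I, Complex.norm_real,
      Real.norm_eq_abs, div_pow, one_pow, one_div_mul_eq_div]
    gcongr
    exact hB x t

end IsRapidOffZero

/- The difference `f - lineFourier K` is a polynomial because its inverse Fourier transform is
supported at `0`. -/
lemma IsLineSymbol.eq_sum_add_lineFourier {K : X → ℝ → ℂ} (hK : IsRapidOffZero K) {d : ℝ}
    {f : ℕ → ℝ → ℂ} (hf : IsLineSymbol d f) {x : X} (hfK : RepOffZero (f 0) (K x)) {N : ℕ}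
    (hN : d - N ≤ -2) (t : ℝ) :
    f 0 t = ∑ r ∈ Finset.range N,
      (f r 0 - lineFourier (fun z : ℝ => (-Complex.I * z) ^ r * K x z) 0) / r.factorial *
        (t : ℂ) ^ r + lineFourier (K x) t := by
  have hint := hf.integrable hN
  have hrep := hf.repOffZero_add N 0 hfK
  rw [zero_add] at hrep
  have heq := (RepOffZero.of_integrable hint).eqOn (continuous_invFourierLine hint).continuousOn
    (((hK.pow_mul N).contDiffOn x).continuousOn) hrep
  have hae := ae_ne_zero.mono fun z hz => heq hz
  have hzero (t : ℝ) :
      f N t - lineFourier (fun z : ℝ => (-Complex.I * z) ^ N * K x z) t = 0 := by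
    rw [sub_eq_zero, ← lineFourier_invFourierLine (hf.continuous N) hint
      (((hK.pow_mul N).integrable x).congr (hae.mono fun z hz => hz.symm)) t]
    exact integral_congr_ae (hae.mono fun z hz => congrArg _ hz)
  have htaylor := eq_taylor_of_deriv_eq_zero
    (fun r t => (hf.hasDerivAt r t).sub (hK.hasDerivAt_lineFourier r x t)) hzero t
  simp only [Pi.sub_apply, pow_zero, one_mul] at htaylor
  rw [← sub_eq_iff_eq_add, htaylor]

lemma IsLineSymbol.exists_norm_le_mul_rpow {d : ℝ} {f : ℕ → ℝ → ℂ} (hf : IsLineSymbol d f) :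
    ∃ C : ℝ, ∀ t : ℝ, 1 ≤ t → ‖f 0 t‖ ≤ C * t ^ d := by
  obtain ⟨C, hC⟩ := hf.bound 0
  refine ⟨|C| * 2 ^ |d|, fun t ht => (hC t).trans ?_⟩
  have htpos : 0 < t := one_pos.trans_le ht
  rw [Nat.cast_zero, sub_zero, mul_assoc, abs_of_pos htpos]
  exact mul_le_mul (le_abs_self C) (rpow_le_of_comparable (by positivity) htpos (by linarith)
    (by linarith) d) (by positivity) (abs_nonneg C)

lemma exists_hasLaurentExpansion {d : ℝ} (f : X → ℕ → ℝ → ℂ) (hf : ∀ x, IsLineSymbol d (f x))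
    (hf0 : ∀ r, ∃ C : ℝ, ∀ x, ‖f x r 0‖ ≤ C) {K : X → ℝ → ℂ} (hK : IsRapidOffZero K)
    (hfK : ∀ x, RepOffZero (f x 0) (K x)) :
    ∃ c, HasLaurentExpansion (fun _ => 1) d (fun x => f x 0) c := by
  obtain ⟨N, hN⟩ : ∃ N : ℕ, d + 2 ≤ N := exists_nat_ge _
  set A : ℕ → X → ℂ := fun r x =>
    (f x r 0 - lineFourier (fun z : ℝ => (-Complex.I * z) ^ r * K x z) 0) / r.factorial with hA
  refine ⟨fun | Int.ofNat r => fun x => if r < N then A r x else 0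
              | Int.negSucc i => fun x => jumpCoeff (K x) i, ?_⟩
  refine HasLaurentExpansion.of_growth (e := ((N - 1 : ℤ) : ℝ)) ⟨?_, ?_, ?_⟩
    fun x => (hf x).exists_norm_le_mul_rpow
  · rintro (r | i)
    · obtain ⟨B, hB⟩ := hf0 r
      obtain ⟨C, hC⟩ := (hK.pow_mul r).exists_norm_lineFourier_le
      refine ⟨(B + C) / r.factorial, fun x => ?_⟩
      have hle : ‖A r x‖ ≤ (B + C) / r.factorial := by
        rw [hA, norm_div, Complex.norm_natCast]
        gcongr
        exact norm_sub_le_of_le (hB x) (hC x 0)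
      rw [Real.one_rpow, mul_one]
      dsimp only
      split_ifs
      · exact hle
      · simpa using (norm_nonneg _).trans hle
    · simpa using hK.exists_norm_jumpCoeff_le i
  · rintro (r | i) hj x
    · rw [Int.cast_lt, Int.ofNat_eq_natCast] at hj
      exact if_neg (by omega)
    · rw [Int.cast_lt] at hj
      omega
  · intro m
    obtain ⟨C, hC⟩ := hK.exists_lineFourier_sub_sum_le m
    refine ⟨C, fun x t ht => ?_⟩
    rw [Int.floor_intCast, sum_Icc_neg_eq, Real.one_rpow, mul_one,
      (hf x).eq_sum_add_lineFourier hK (hfK x) (sub_le_iff_le_add.2 (by linarith)) t]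
    refine (congrArg norm ?_).trans_le (hC x t ht)
    rw [add_sub_add_comm, add_eq_right, sub_eq_zero]
    exact Finset.sum_congr rfl fun r hr => by
      rw [zpow_natCast]
      exact congrArg (· * _) (if_pos (Finset.mem_range.1 hr)).symm

end LaurentExpansion

section TangentialTaylor

variable {k : ℕ} {d : ℝ} {p : Euc (k + 1) × Euc (k + 1) → ℂ}

/-- The operator `c ↦ (α ↦ ∑ᵢ i ξᵢ c(α + eᵢ))` on families indexed by multi-indices; applied to the
derivatives `D_ξ^α q` of a function it gives the derivatives of the directional derivative of `q`
along `(ξ, 0)`. -/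
noncomputable def tangentialOp (ξ : Euc k) : Module.End ℂ ((Fin (k + 1) → ℕ) → ℂ) where
  toFun F := fun α => ∑ i, Complex.I * ξ i * F (α + Pi.single i.castSucc 1)
  map_add' F G := by
    funext α
    simp only [Pi.add_apply, mul_add, Finset.sum_add_distrib]
  map_smul' c F := by
    funext α
    simp only [Pi.smul_apply, smul_eq_mul, RingHom.id_apply, Finset.mul_sum]
    exact Finset.sum_congr rfl fun i _ => mul_left_comm _ _ _

lemma tangentialOp_apply (ξ : Euc k) (F : (Fin (k + 1) → ℕ) → ℂ) (α : Fin (k + 1) → ℕ) :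
    tangentialOp ξ F α = ∑ i, Complex.I * ξ i * F (α + Pi.single i.castSucc 1) := rfl

lemma tangentialOp_pow_succ (ξ : Euc k) (r : ℕ) (F : (Fin (k + 1) → ℕ) → ℂ)
    (α : Fin (k + 1) → ℕ) :
    (tangentialOp ξ ^ (r + 1)) F α =
      ∑ i, Complex.I * ξ i * (tangentialOp ξ ^ r) F (α + Pi.single i.castSucc 1) := by
  rw [pow_succ', Module.End.mul_apply, tangentialOp_apply]

lemma tangentialOp_pow_sum_mul {ι : Type*} (ξ : Euc k) (r : ℕ) (s : Finset ι)
    (F : (Fin (k + 1) → ℕ) → ι → ℂ) (a : ι → ℂ) (α : Fin (k + 1) → ℕ) :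
    (tangentialOp ξ ^ r) (fun γ => ∑ j ∈ s, F γ j * a j) α =
      ∑ j ∈ s, (tangentialOp ξ ^ r) (F · j) α * a j := by
  have hsum : (fun γ => ∑ j ∈ s, F γ j * a j) = ∑ j ∈ s, a j • (F · j) := by
    funext γ
    simp [mul_comm]
  rw [hsum, map_sum, Finset.sum_apply]
  exact Finset.sum_congr rfl fun j _ => by rw [map_smul, Pi.smul_apply, smul_eq_mul, mul_comm]

lemma norm_tangentialOp_pow_le {Y : Type*} (F : Y → (Fin (k + 1) → ℕ) → ℂ) (ξ : Y → Euc k)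
    (w : Y → ℝ) (r : ℕ) (α : Fin (k + 1) → ℕ)
    (hF : ∀ γ, multiLength γ = multiLength α + r → ∃ C : ℝ, ∀ y, ‖F y γ‖ ≤ C * w y) :
    ∃ C : ℝ, ∀ y, ‖(tangentialOp (ξ y) ^ r) (F y) α‖ ≤ C * (japBracket (ξ y) ^ r * w y) := by
  induction r generalizing α with
  | zero => simpa using hF α rfl
  | succ r ih =>
    choose C hC using fun i : Fin k => ih (α + Pi.single i.castSucc 1) fun γ hγ =>
      hF γ (by rw [hγ, multiLength_add, multiLength_single]; ring)
    refine ⟨∑ i, C i, fun y => ?_⟩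
    rw [tangentialOp_pow_succ, Finset.sum_mul]
    refine norm_sum_le_of_le _ fun i _ => ?_
    rw [norm_mul, norm_mul, Complex.norm_I, one_mul, Complex.norm_real, Real.norm_eq_abs]
    calc |ξ y i| * ‖(tangentialOp (ξ y) ^ r) (F y) (α + Pi.single i.castSucc 1)‖
        ≤ japBracket (ξ y) * (C i * (japBracket (ξ y) ^ r * w y)) :=
          mul_le_mul (abs_apply_le_japBracket _ _) (hC i y) (norm_nonneg _) (japBracket_pos _).le
      _ = C i * (japBracket (ξ y) ^ (r + 1) * w y) := by ring

lemma tangentialOp_pow_eq_zero (ξ : Euc k) (F : (Fin (k + 1) → ℕ) → ℂ) (r : ℕ)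
    (α : Fin (k + 1) → ℕ) (hF : ∀ γ, multiLength γ = multiLength α + r → F γ = 0) :
    (tangentialOp ξ ^ r) F α = 0 := by
  obtain ⟨C, hC⟩ := norm_tangentialOp_pow_le (fun _ : Unit => F) (fun _ => ξ) (fun _ => 0) r α
    fun γ hγ => ⟨0, fun _ => by simp [hF γ hγ]⟩
  simpa using hC ()

lemma tangentialOp_pow_polynomial (F : (Fin (k + 1) → ℕ) → ℂ) (r : ℕ) (α : Fin (k + 1) → ℕ) :
    ∃ P : MvPolynomial (Fin k) ℂ, P.totalDegree ≤ r ∧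
      ∀ ξ : Euc k, (tangentialOp ξ ^ r) F α = MvPolynomial.eval (fun i => (ξ i : ℂ)) P := by
  induction r generalizing α with
  | zero => exact ⟨MvPolynomial.C (F α), by simp, fun ξ => by simp⟩
  | succ r ih =>
    choose P hdeg heval using fun i : Fin k => ih (α + Pi.single i.castSucc 1)
    refine ⟨∑ i, MvPolynomial.C Complex.I * MvPolynomial.X i * P i,
      MvPolynomial.totalDegree_finsetSum_le fun i _ => ?_, fun ξ => ?_⟩
    · have hlinear : (MvPolynomial.C Complex.I * MvPolynomial.X i :
          MvPolynomial (Fin k) ℂ).totalDegree ≤ 1 :=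
        (MvPolynomial.totalDegree_mul _ _).trans (by simp)
      have := (MvPolynomial.totalDegree_mul (MvPolynomial.C Complex.I * MvPolynomial.X i) (P i))
      have := hdeg i
      omega
    · rw [tangentialOp_pow_succ, map_sum]
      exact Finset.sum_congr rfl fun i _ => by simp [heval i ξ]

lemma hasDerivAt_tangentialOp_pow (ξ : Euc k) {U : ℝ → (Fin (k + 1) → ℕ) → ℂ}
    (hU : ∀ γ τ, HasDerivAt (fun τ => U τ γ) (tangentialOp ξ (U τ) γ) τ) (r : ℕ)
    (α : Fin (k + 1) → ℕ) (τ : ℝ) :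
    HasDerivAt (fun τ => (tangentialOp ξ ^ r) (U τ) α) ((tangentialOp ξ ^ (r + 1)) (U τ) α) τ := by
  induction r generalizing α with
  | zero => simpa using hU α τ
  | succ r ih =>
    have h := HasDerivAt.fun_sum (u := Finset.univ) fun (i : Fin k) _ =>
      (ih (α + Pi.single i.castSucc 1)).const_mul (Complex.I * ξ i)
    simpa only [← tangentialOp_pow_succ] using h

lemma hasDerivAt_normalSlice_ray (hp : ContDiff ℝ ∞ p) (α β : Fin (k + 1) → ℕ) (x ξ : Euc k)
    (t τ : ℝ) :
    HasDerivAt (fun τ : ℝ => normalSlice p α β x (τ • ξ) t)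
      (tangentialOp ξ (fun γ => normalSlice p γ β x (τ • ξ) t) α) τ := by
  have hray : HasDerivAt (fun τ : ℝ => (x, τ • ξ)) ((0 : Euc k), ξ) τ := by
    refine (hasDerivAt_const _ _).prodMk ?_
    simpa using (hasDerivAt_id τ).smul_const ξ
  refine ((hasFDerivAt_normalSlice hp α β t (x, τ • ξ)).comp_hasDerivAt τ hray).congr_deriv ?_
  rw [_root_.smul_apply, gradCLM_apply, tangentialOp_apply]
  simp [Finset.mul_sum, mul_assoc]

lemma japBracket_smul_le {τ : ℝ} (hτ : τ ∈ Set.Icc (0 : ℝ) 1) (ξ : Euc k) :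
    japBracket (τ • ξ) ≤ japBracket ξ := by
  have hnorm : ‖τ • ξ‖ ≤ ‖ξ‖ := by
    rw [norm_smul, Real.norm_of_nonneg hτ.1]
    exact mul_le_of_le_one_left (norm_nonneg ξ) hτ.2
  exact Real.sqrt_le_sqrt (by gcongr)

lemma IsSymbol.exists_norm_normalSlice_le_of_le_abs (hp : IsSymbol d p) (α β : Fin (k + 1) → ℕ) :
    ∃ C : ℝ, ∀ (x ξ : Euc k) (t : ℝ), japBracket ξ ≤ |t| →
      ‖normalSlice p α β x ξ t‖ ≤ C * |t| ^ (d - multiLength α) := by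
  obtain ⟨C, hC0, hC⟩ := hp.norm_normalSlice_le α β
  refine ⟨C * 2 ^ |d - multiLength α|, fun x ξ t ht => (hC x ξ t).trans ?_⟩
  rw [mul_assoc]
  refine mul_le_mul_of_nonneg_left (rpow_le_of_comparable (japBracket_pos _)
    ((japBracket_pos ξ).trans_le ht) ?_ ?_ _) hC0
  · linarith [japBracket_joinLast_le ξ t]
  · linarith [abs_le_japBracket_joinLast ξ t, abs_nonneg t]

lemma IsSymbol.exists_norm_sub_tangentialTaylor_le (hp : IsSymbol d p) (α β : Fin (k + 1) → ℕ)
    (N : ℕ) :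
    ∃ C : ℝ, ∀ (x ξ : Euc k) (t : ℝ), japBracket ξ ≤ |t| →
      ‖normalSlice p α β x ξ t - ∑ r ∈ Finset.range N, (r.factorial : ℂ)⁻¹ *
        (tangentialOp ξ ^ r) (fun γ => normalSlice p γ β x 0 t) α‖
      ≤ C * (japBracket ξ ^ N * |t| ^ (d - multiLength α - N)) := by
  obtain ⟨C, hC⟩ := norm_tangentialOp_pow_le
    (Y := {y : (Euc k × Euc k) × ℝ × ℝ // japBracket y.1.2 ≤ |y.2.1| ∧ y.2.2 ∈ Set.Icc (0 : ℝ) 1})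
    (fun y γ => normalSlice p γ β y.1.1.1 (y.1.2.2 • y.1.1.2) y.1.2.1) (fun y => y.1.1.2)
    (fun y => |y.1.2.1| ^ (d - multiLength α - N)) N α fun γ hγ => by
      obtain ⟨C, hC⟩ := hp.exists_norm_normalSlice_le_of_le_abs γ β
      rw [hγ, Nat.cast_add, ← sub_sub] at hC
      exact ⟨C, fun ⟨⟨⟨x, ξ⟩, t, τ⟩, ht, hτ⟩ => hC x _ t ((japBracket_smul_le hτ ξ).trans ht)⟩
  refine ⟨C, fun x ξ t ht => ?_⟩
  have htaylor := norm_sub_taylor_le N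
    (M := C * (japBracket ξ ^ N * |t| ^ (d - multiLength α - N)))
    (φ := fun r τ => (tangentialOp ξ ^ r) (fun γ => normalSlice p γ β x (τ • ξ) t) α)
    (hasDerivAt_tangentialOp_pow ξ (fun γ τ => hasDerivAt_normalSlice_ray hp.1 γ β x ξ t τ) · α)
    (fun τ hτ => hC ⟨((x, ξ), t, τ), ht, hτ⟩) 1 (Set.right_mem_Icc.2 zero_le_one)
  simp only [pow_zero, Module.End.one_apply, one_smul, zero_smul, Complex.ofReal_one, one_pow,
    one_div] at htaylor
  simpa only [mul_comm] using htaylor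

end TangentialTaylor

section ExpansionCoeff

variable {k : ℕ} {d : ℝ} {p : Euc (k + 1) × Euc (k + 1) → ℂ}

lemma IsSymbolUTTR.exists_isRapidOffZero (hp : IsSymbolUTTR d p) (α β : Fin (k + 1) → ℕ)
    (ξ : Euc k) :
    ∃ K : Euc k → ℝ → ℂ, IsRapidOffZero K ∧ ∀ x, RepOffZero (normalSlice p α β x ξ) (K x) := by
  choose K hK using fun x => hp.1.exists_isInvFourierOffZero α β x ξ
  simp only [isInvFourierOffZero_iff] at hK
  refine ⟨K, ⟨fun x => (hK x).1, fun l m => ?_⟩, fun x => (hK x).2⟩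
  obtain ⟨C, hC⟩ := hp.2 α β l m ξ
  refine ⟨C, fun x z hz => ?_⟩
  obtain ⟨L, hL, hLC⟩ := hC x
  rw [isInvFourierOffZero_iff] at hL
  have heq : Set.EqOn (K x) L {0}ᶜ :=
    (hK x).2.eqOn (hK x).1.continuousOn hL.1.continuousOn hL.2
  rw [heq.iteratedDeriv_of_isOpen isOpen_compl_singleton m hz]
  simpa [weightedD] using hLC z hz

lemma IsSymbolUTTR.exists_hasLaurentExpansion_zero (hp : IsSymbolUTTR d p)
    (α β : Fin (k + 1) → ℕ) :
    ∃ c : ℤ → Euc k → ℂ, HasLaurentExpansion (fun _ => 1) (d - multiLength α)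
      (fun x => normalSlice p α β x 0) c := by
  obtain ⟨K, hK, hrep⟩ := hp.exists_isRapidOffZero α β 0
  have hnorm (r : ℕ) : ∃ C : ℝ, ∀ x : Euc k, ‖Complex.I ^ r *
      normalSlice p (α + Pi.single (Fin.last k) r) β x 0 0‖ ≤ C := by
    obtain ⟨C, -, hC⟩ := hp.1.norm_normalSlice_le (α + Pi.single (Fin.last k) r) β
    simp only [norm_mul, norm_pow, Complex.norm_I, one_pow, one_mul]
    exact ⟨_, fun x => hC x 0 0⟩
  set f : Euc k → ℕ → ℝ → ℂ := fun x r t =>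
    Complex.I ^ r * normalSlice p (α + Pi.single (Fin.last k) r) β x 0 t
  have hf_zero : (fun x => f x 0) = fun x => normalSlice p α β x 0 := by
    funext x t
    simp [f]
  rw [← hf_zero]
  exact exists_hasLaurentExpansion f (fun x => hp.1.isLineSymbol_normalSlice α β x 0) hnorm hK
    fun x => (congrFun hf_zero x).symm ▸ hrep x

/-- The Taylor polynomial in `ξ'` at `ξ' = 0` of the coefficient of order `j`, built from the
coefficients `c γ j` of the `ξ'`-derivatives at `ξ' = 0`. It stops where the orders `d - |γ|` of
the latter fall below `j`. -/
noncomputable def expansionCoeff (d : ℝ) (c : (Fin (k + 1) → ℕ) → ℤ → Euc k → ℂ)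
    (α : Fin (k + 1) → ℕ) (j : ℤ) (y : Euc k × Euc k) : ℂ :=
  ∑ r ∈ Finset.range (⌊d - multiLength α⌋ - j + 1).toNat,
    (r.factorial : ℂ)⁻¹ * (tangentialOp y.2 ^ r) (fun γ => c γ j y.1) α

variable {c : (Fin (k + 1) → ℕ) → ℤ → Euc k → ℂ}

lemma expansionCoeff_eq_zero {α : Fin (k + 1) → ℕ} {j : ℤ} (h : d - multiLength α < j)
    (y : Euc k × Euc k) : expansionCoeff d c α j y = 0 := by
  have hempty : (⌊d - multiLength α⌋ - j + 1).toNat = 0 := by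
    have := Int.floor_lt.2 h
    omega
  rw [expansionCoeff, hempty, Finset.sum_range_zero]

lemma cast_le_of_lt_toNat_floor_sub {e : ℝ} {j : ℤ} {r : ℕ} (hr : r < (⌊e⌋ - j + 1).toNat) :
    (r : ℝ) ≤ e - j := by
  have hr' : (r : ℤ) + j ≤ ⌊e⌋ := by omega
  have := Int.le_floor.1 hr'
  push_cast at this
  linarith

lemma expansionCoeff_polynomial (α : Fin (k + 1) → ℕ) {j : ℤ} (hj : (j : ℝ) ≤ d - multiLength α)
    (x : Euc k) :
    IsPolynomialOfDegreeLE (d - j - multiLength α) (fun ξ => expansionCoeff d c α j (x, ξ)) := by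
  choose P hdeg heval using fun r => tangentialOp_pow_polynomial (fun γ => c γ j x) r α
  refine ⟨∑ r ∈ Finset.range (⌊d - multiLength α⌋ - j + 1).toNat,
    MvPolynomial.C (r.factorial : ℂ)⁻¹ * P r, ?_, fun ξ => ?_⟩
  · have hfloor : 0 ≤ d - j - multiLength α := by linarith
    rw [← Nat.le_floor_iff hfloor]
    refine MvPolynomial.totalDegree_finsetSum_le fun r hr => ?_
    refine (MvPolynomial.totalDegree_mul _ _).trans ?_
    rw [MvPolynomial.totalDegree_C, zero_add]
    refine (hdeg r).trans (Nat.le_floor ?_)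
    linarith [cast_le_of_lt_toNat_floor_sub (Finset.mem_range.1 hr)]
  · simp only [expansionCoeff, map_sum, map_mul, MvPolynomial.eval_C, heval]

lemma norm_inv_factorial_mul_le (r : ℕ) (z : ℂ) : ‖(r.factorial : ℂ)⁻¹ * z‖ ≤ ‖z‖ := by
  rw [norm_mul, norm_inv, Complex.norm_natCast]
  exact mul_le_of_le_one_left (norm_nonneg z)
    (inv_le_one_of_one_le₀ (by exact_mod_cast r.factorial_pos))

lemma norm_expansionCoeff_le {j : ℤ} (hc : ∀ γ, ∃ C : ℝ, ∀ x, ‖c γ j x‖ ≤ C)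
    (α : Fin (k + 1) → ℕ) : ∃ C : ℝ, ∀ y : Euc k × Euc k,
      ‖expansionCoeff d c α j y‖ ≤ C * japBracket y.2 ^ (d - multiLength α - j) := by
  choose C hC using fun r => norm_tangentialOp_pow_le
    (fun (y : Euc k × Euc k) γ => c γ j y.1) (fun y => y.2) (fun _ => 1) r α fun γ _ => by
      obtain ⟨C, hC⟩ := hc γ
      exact ⟨C, fun y => by simpa using hC y.1⟩
  refine ⟨∑ r ∈ Finset.range (⌊d - multiLength α⌋ - j + 1).toNat, |C r|, fun y => ?_⟩
  rw [expansionCoeff, Finset.sum_mul]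
  refine norm_sum_le_of_le _ fun r hr => (norm_inv_factorial_mul_le r _).trans ?_
  have hpow : japBracket y.2 ^ r ≤ japBracket y.2 ^ (d - multiLength α - j) := by
    rw [← Real.rpow_natCast]
    exact Real.rpow_le_rpow_of_exponent_le (one_le_japBracket y.2)
      (cast_le_of_lt_toNat_floor_sub (Finset.mem_range.1 hr))
  calc ‖(tangentialOp y.2 ^ r) (fun γ => c γ j y.1) α‖
      ≤ C r * japBracket y.2 ^ r := by simpa using hC r y
    _ ≤ |C r| * japBracket y.2 ^ (d - multiLength α - j) :=
        mul_le_mul (le_abs_self _) hpow (pow_nonneg (japBracket_pos _).le _) (abs_nonneg _)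

lemma expansionCoeff_eq_sum_range (hc : ∀ γ (j : ℤ), d - multiLength γ < j → ∀ x, c γ j x = 0)
    (α : Fin (k + 1) → ℕ) (j : ℤ) (y : Euc k × Euc k) {N : ℕ}
    (hN : ⌊d - multiLength α⌋ - j + 1 ≤ N) :
    expansionCoeff d c α j y =
      ∑ r ∈ Finset.range N, (r.factorial : ℂ)⁻¹ *
        (tangentialOp y.2 ^ r) (fun γ => c γ j y.1) α := by
  refine Finset.sum_subset (Finset.range_subset_range.2 (Int.toNat_le.2 hN)) fun r _ hr => ?_
  rw [tangentialOp_pow_eq_zero _ _ _ _ fun γ hγ => hc γ j ?_ y.1, mul_zero]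
  have hlt : ⌊d - multiLength α⌋ < j + r := by
    rw [Finset.mem_range] at hr
    omega
  have := Int.floor_lt.1 hlt
  rw [hγ]
  push_cast at this ⊢
  linarith

lemma sum_expansionCoeff_mul_zpow (hc : ∀ γ (j : ℤ), d - multiLength γ < j → ∀ x, c γ j x = 0)
    (α : Fin (k + 1) → ℕ) {m N : ℕ} (hN : ⌊d - multiLength α⌋ + m + 1 ≤ N) (y : Euc k × Euc k)
    (t : ℝ) :
    ∑ j ∈ Finset.Icc (-(m : ℤ)) ⌊d - multiLength α⌋, expansionCoeff d c α j y * (t : ℂ) ^ j =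
      ∑ r ∈ Finset.range N, (r.factorial : ℂ)⁻¹ * (tangentialOp y.2 ^ r)
        (fun γ => ∑ j ∈ Finset.Icc (-(m : ℤ)) ⌊d - multiLength α⌋, c γ j y.1 * (t : ℂ) ^ j) α := by
  simp only [tangentialOp_pow_sum_mul _ _ _ (fun γ j => c γ j y.1), Finset.mul_sum]
  rw [Finset.sum_comm]
  refine Finset.sum_congr rfl fun j hj => ?_
  have := (Finset.mem_Icc.1 hj).1
  rw [expansionCoeff_eq_sum_range hc α j y (N := N) (by omega), Finset.sum_mul]
  exact Finset.sum_congr rfl fun r _ => mul_assoc _ _ _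

variable {β : Fin (k + 1) → ℕ}

lemma norm_tangentialOp_pow_remainder_le {f : (Fin (k + 1) → ℕ) → Euc k → ℝ → ℂ}
    (hf : ∀ γ, HasLaurentExpansion (fun _ => 1) (d - multiLength γ) (f γ) (c γ))
    (α : Fin (k + 1) → ℕ) (m r : ℕ) :
    ∃ C : ℝ, ∀ (x ξ : Euc k) (t : ℝ), 1 ≤ |t| →
      ‖(tangentialOp ξ ^ r) (fun γ => f γ x t -
        ∑ j ∈ Finset.Icc (-(m : ℤ)) ⌊d - multiLength α⌋, c γ j x * (t : ℂ) ^ j) α‖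
      ≤ C * (japBracket ξ ^ r * (|t| ^ (m + 1))⁻¹) := by
  have hle {γ : Fin (k + 1) → ℕ} (hγ : multiLength γ = multiLength α + r) :
      d - multiLength γ ≤ d - multiLength α := by
    rw [hγ, Nat.cast_add]
    linarith [r.cast_nonneg (α := ℝ)]
  obtain ⟨C, hC⟩ := norm_tangentialOp_pow_le (Y := {y : (Euc k × Euc k) × ℝ // 1 ≤ |y.2|})
    (fun y γ => f γ y.1.1.1 y.1.2 - ∑ j ∈ Finset.Icc (-(m : ℤ)) ⌊d - multiLength α⌋,
      c γ j y.1.1.1 * (y.1.2 : ℂ) ^ j)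
    (fun y => y.1.1.2) (fun y => (|y.1.2| ^ (m + 1))⁻¹) r α fun γ hγ => by
      obtain ⟨C, hC⟩ := (hf γ).remainder m
      refine ⟨C, fun ⟨⟨⟨x, ξ⟩, t⟩, ht⟩ => ?_⟩
      have hzero (j : ℤ) (hj : d - multiLength γ < j) : c γ j x * (t : ℂ) ^ j = 0 := by
        rw [(hf γ).coeff_eq_zero j hj, zero_mul]
      dsimp only
      rw [sum_Icc_floor_eq (fun j hj => hzero j ((hle hγ).trans_lt hj)) hzero]
      simpa [div_eq_mul_inv] using hC x t ht
  exact ⟨C, fun x ξ t ht => hC ⟨((x, ξ), t), ht⟩⟩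

lemma pow_mul_rpow_sub_le {a T e : ℝ} {m N : ℕ} (ha : 0 < a) (haT : a ≤ T) (hN : e + 1 + m ≤ N) :
    a ^ N * T ^ (e - N) ≤ a ^ (e + 1 + m) * (T ^ (m + 1))⁻¹ := by
  have hT : 0 < T := ha.trans_le haT
  calc a ^ N * T ^ (e - N)
      = a ^ N * (T ^ (e + 1 + m - N) * (T ^ (m + 1))⁻¹) := by
        rw [← Real.rpow_natCast T, ← Real.rpow_neg hT.le, ← Real.rpow_add hT]
        push_cast
        ring_nf
    _ ≤ a ^ N * (a ^ (e + 1 + m - N) * (T ^ (m + 1))⁻¹) := by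
        have := Real.rpow_le_rpow_of_nonpos ha haT (sub_nonpos.2 hN)
        gcongr
    _ = a ^ (e + 1 + m) * (T ^ (m + 1))⁻¹ := by
        rw [← mul_assoc, ← Real.rpow_natCast a, ← Real.rpow_add ha, add_sub_cancel]

lemma IsSymbol.hasLaurentExpansion_expansionCoeff (hp : IsSymbol d p)
    (hc : ∀ γ, HasLaurentExpansion (fun _ => 1) (d - multiLength γ)
      (fun x => normalSlice p γ β x 0) (c γ)) (α : Fin (k + 1) → ℕ) :
    HasLaurentExpansion (fun y : Euc k × Euc k => japBracket y.2) (d - multiLength α)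
      (fun y => normalSlice p α β y.1 y.2) (expansionCoeff d c α) where
  coeff_bound j := norm_expansionCoeff_le
    (fun γ => by simpa using (hc γ).coeff_bound j) α
  coeff_eq_zero j hj := expansionCoeff_eq_zero hj
  remainder m := by
    set e := d - multiLength α
    set N := ⌈e + 1 + m⌉₊
    obtain ⟨A, hA⟩ := hp.exists_norm_sub_tangentialTaylor_le α β N
    choose B hB using norm_tangentialOp_pow_remainder_le hc α m
    refine ⟨|A| + ∑ r ∈ Finset.range N, |B r|, fun ⟨x, ξ⟩ t ht => ?_⟩
    have hone : 1 ≤ |t| := (one_le_japBracket ξ).trans ht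
    have htpos : 0 < |t| := one_pos.trans_le hone
    have hN : ⌊e⌋ + m + 1 ≤ N := by
      have := (add_assoc (⌊e⌋ : ℝ) m 1).trans_le
        ((by linarith [Int.floor_le e] : (⌊e⌋ : ℝ) + (m + 1) ≤ e + 1 + m).trans (Nat.le_ceil _))
      exact_mod_cast this
    have hsplit : normalSlice p α β x ξ t -
        ∑ j ∈ Finset.Icc (-(m : ℤ)) ⌊e⌋, expansionCoeff d c α j (x, ξ) * (t : ℂ) ^ j =
        (normalSlice p α β x ξ t - ∑ r ∈ Finset.range N, (r.factorial : ℂ)⁻¹ *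
          (tangentialOp ξ ^ r) (fun γ => normalSlice p γ β x 0 t) α) +
        ∑ r ∈ Finset.range N, (r.factorial : ℂ)⁻¹ * (tangentialOp ξ ^ r)
          (fun γ => normalSlice p γ β x 0 t -
            ∑ j ∈ Finset.Icc (-(m : ℤ)) ⌊e⌋, c γ j x * (t : ℂ) ^ j) α := by
      rw [sum_expansionCoeff_mul_zpow (fun γ => (hc γ).coeff_eq_zero) α hN (x, ξ) t,
        ← sub_add_sub_cancel _ (∑ r ∈ Finset.range N, (r.factorial : ℂ)⁻¹ *
          (tangentialOp ξ ^ r) (fun γ => normalSlice p γ β x 0 t) α), ← Finset.sum_sub_distrib]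
      simp only [← mul_sub, ← Pi.sub_apply, ← map_sub]
      rfl
    rw [hsplit, div_eq_mul_inv, mul_assoc, add_mul, Finset.sum_mul]
    refine norm_add_le_of_le ((hA x ξ t ht).trans ?_) (norm_sum_le_of_le _ fun r hr =>
      (norm_inv_factorial_mul_le r _).trans ((hB r x ξ t hone).trans ?_))
    · have := Real.rpow_nonneg htpos.le (e - N)
      exact mul_le_mul (le_abs_self A) (pow_mul_rpow_sub_le (japBracket_pos ξ) ht (Nat.le_ceil _))
        (mul_nonneg (pow_nonneg (japBracket_pos ξ).le N) this) (abs_nonneg A)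
    · have hpow : japBracket ξ ^ r ≤ japBracket ξ ^ (e + 1 + m) := by
        rw [← Real.rpow_natCast]
        exact Real.rpow_le_rpow_of_exponent_le (one_le_japBracket ξ)
          (Nat.lt_ceil.1 (Finset.mem_range.1 hr)).le
      have := japBracket_pos ξ
      gcongr
      exact le_abs_self (B r)

end ExpansionCoeff

section LaurentRemainderBounds

open Filter Topology

lemma laurentRemainder_eq_mul (M : ℤ) (f : ℝ → ℂ) (c : ℤ → ℂ) (m : ℕ) {t : ℝ} (ht : t ≠ 0) :
    laurentRemainder M f c m t =
      (t : ℂ) ^ m * (f t - ∑ j ∈ Finset.Icc (-(m : ℤ)) M, c j * (t : ℂ) ^ j) := by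
  rw [laurentRemainder, mul_sub, Finset.mul_sum]
  congr 1
  refine Finset.sum_congr rfl fun j _ => ?_
  rw [zpow_add₀ (by exact_mod_cast ht), zpow_natCast]
  ring

lemma rpow_le_rpow_abs {x R : ℝ} (hx : 1 ≤ x) (hxR : x ≤ R) (r : ℝ) : x ^ r ≤ R ^ |r| :=
  (Real.rpow_le_rpow_of_exponent_le hx (le_abs_self r)).trans
    (Real.rpow_le_rpow (zero_le_one.trans hx) hxR (abs_nonneg r))

namespace HasLaurentExpansion

variable {X : Type*} {w : X → ℝ} {e : ℝ} {f : X → ℝ → ℂ} {c : ℤ → X → ℂ}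

lemma exists_norm_laurentRemainder_le_of_abs_le (h : HasLaurentExpansion w e f c)
    (hw : ∀ x, 0 < w x) (hf : ∃ C : ℝ, ∀ x (t : ℝ), |t| ≤ w x → ‖f x t‖ ≤ C * w x ^ e) (m : ℕ) :
    ∃ C : ℝ, ∀ x (t : ℝ), |t| ≤ w x →
      ‖laurentRemainder ⌊e⌋ (f x) (c · x) m t‖ ≤ C * w x ^ (e + m) := by
  obtain ⟨A, hA⟩ := hf
  choose B hB using h.coeff_bound
  refine ⟨A + ∑ j ∈ Finset.Icc (-(m : ℤ)) ⌊e⌋, B j, fun x t ht => ?_⟩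
  rw [add_mul, Finset.sum_mul]
  refine norm_sub_le_of_le ?_ (norm_sum_le_of_le _ fun j hj => ?_)
  · rw [norm_mul, norm_pow, Complex.norm_real, Real.norm_eq_abs, Real.rpow_add (hw x),
      Real.rpow_natCast, ← mul_assoc, mul_comm]
    exact mul_le_mul (hA x t ht) (by gcongr) (by positivity) ((norm_nonneg _).trans (hA x t ht))
  · have hjm : 0 ≤ j + m := by linarith [(Finset.mem_Icc.1 hj).1]
    have hexp : e + m = e - j + ((j + m : ℤ) : ℝ) := by push_cast; ring
    rw [norm_mul, norm_zpow, Complex.norm_real, Real.norm_eq_abs, hexp, Real.rpow_add (hw x),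
      Real.rpow_intCast, ← mul_assoc]
    exact mul_le_mul (hB j x) (zpow_le_zpow_left₀ hjm (abs_nonneg t) ht) (by positivity)
      ((norm_nonneg _).trans (hB j x))

lemma exists_norm_laurentRemainder_le (h : HasLaurentExpansion w e f c) (hw : ∀ x, 0 < w x)
    (hf : ∃ C : ℝ, ∀ x (t : ℝ), |t| ≤ w x → ‖f x t‖ ≤ C * w x ^ e) (m : ℕ) :
    ∃ C : ℝ, ∀ x (t : ℝ), ‖laurentRemainder ⌊e⌋ (f x) (c · x) m t‖ ≤
      C * w x ^ (e + 1 + m) * (w x + |t|)⁻¹ := by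
  obtain ⟨A, hA⟩ := h.exists_norm_laurentRemainder_le_of_abs_le hw hf m
  obtain ⟨B, hB⟩ := h.remainder m
  have hinv {a b : ℝ} (ha : 0 < a) (hb : 0 ≤ b) (hba : b ≤ a) : a⁻¹ ≤ 2 * (a + b)⁻¹ := by
    rw [← div_eq_mul_inv, inv_eq_one_div, div_le_div_iff₀ ha (by linarith)]
    linarith
  refine ⟨2 * max |A| |B|, fun x t => ?_⟩
  have hwx := hw x
  have := Real.rpow_pos_of_pos hwx (e + 1 + m)
  suffices hmin : ‖laurentRemainder ⌊e⌋ (f x) (c · x) m t‖ ≤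
      max |A| |B| * w x ^ (e + 1 + m) * (2 * (w x + |t|)⁻¹) from hmin.trans_eq (by ring)
  rcases le_total |t| (w x) with ht | ht
  · have hexp : w x ^ (e + m) = w x ^ (e + 1 + m) * (w x)⁻¹ := by
      rw [← Real.rpow_neg_one, ← Real.rpow_add hwx]
      ring_nf
    refine (hA x t ht).trans ?_
    rw [hexp, ← mul_assoc]
    gcongr
    · exact (le_abs_self A).trans (le_max_left _ _)
    · exact hinv hwx (abs_nonneg t) ht
  · have htpos : 0 < |t| := hwx.trans_le ht
    rw [laurentRemainder_eq_mul _ _ _ _ (abs_pos.1 htpos), norm_mul, norm_pow, Complex.norm_real,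
      Real.norm_eq_abs]
    calc |t| ^ m * ‖f x t - ∑ j ∈ Finset.Icc (-(m : ℤ)) ⌊e⌋, c j x * (t : ℂ) ^ j‖
        ≤ |t| ^ m * (B * w x ^ (e + 1 + m) / |t| ^ (m + 1)) := by
          gcongr
          exact hB x t ht
      _ = B * w x ^ (e + 1 + m) * |t|⁻¹ := by
          field_simp
          ring
      _ ≤ max |A| |B| * w x ^ (e + 1 + m) * (2 * (w x + |t|)⁻¹) := by
          gcongr
          · exact (le_abs_self B).trans (le_max_right _ _)
          · rw [add_comm]
            exact hinv htpos hwx.le ht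

lemma exists_norm_sub_sum_le (h : HasLaurentExpansion w e f c) (hw : ∀ x, 1 ≤ w x) (R : ℝ)
    (j : ℤ) : ∃ C : ℝ, ∀ x (t : ℝ), w x ≤ R → R ≤ t →
      ‖f x t - ∑ i ∈ Finset.Icc j ⌊e⌋, c i x * (t : ℂ) ^ i‖ ≤ C * t ^ (j - 1) := by
  obtain ⟨A, hA⟩ := h.remainder j.natAbs
  choose B hB using h.coeff_bound
  set low := (Finset.Icc (-(j.natAbs : ℤ)) ⌊e⌋).filter (¬j ≤ ·)
  refine ⟨|A| * R ^ |e + 1 + j.natAbs| + ∑ i ∈ low, |B i| * R ^ |e - i|, fun x t hx ht => ?_⟩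
  have hR : 1 ≤ R := (hw x).trans hx
  have hone : 1 ≤ t := hR.trans ht
  have htpos : 0 < t := one_pos.trans_le hone
  have hhigh : (Finset.Icc (-(j.natAbs : ℤ)) ⌊e⌋).filter (j ≤ ·) = Finset.Icc j ⌊e⌋ := by
    ext i
    simp only [Finset.mem_filter, Finset.mem_Icc]
    omega
  have hsplit : f x t - ∑ i ∈ Finset.Icc j ⌊e⌋, c i x * (t : ℂ) ^ i =
      (f x t - ∑ i ∈ Finset.Icc (-(j.natAbs : ℤ)) ⌊e⌋, c i x * (t : ℂ) ^ i) +
        ∑ i ∈ low, c i x * (t : ℂ) ^ i := by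
    rw [← Finset.sum_filter_add_sum_filter_not (Finset.Icc (-(j.natAbs : ℤ)) ⌊e⌋) (j ≤ ·), hhigh]
    ring
  have hrem := hA x t (hx.trans (ht.trans (le_abs_self t)))
  rw [abs_of_pos htpos, div_eq_mul_inv] at hrem
  rw [hsplit, add_mul, Finset.sum_mul]
  refine norm_add_le_of_le (hrem.trans ?_) (norm_sum_le_of_le _ fun i hi => ?_)
  · have hinv : (t ^ (j.natAbs + 1))⁻¹ ≤ t ^ (j - 1) := by
      rw [← zpow_natCast, ← zpow_neg]
      exact zpow_le_zpow_right₀ hone (by omega)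
    have := zero_le_one.trans (hw x)
    gcongr
    · exact le_abs_self A
    · exact rpow_le_rpow_abs (hw x) hx _
  · have hij : i ≤ j - 1 := by
      have := (Finset.mem_filter.1 hi).2
      omega
    rw [norm_mul, norm_zpow, Complex.norm_real, Real.norm_of_nonneg htpos.le]
    have := zero_le_one.trans (hw x)
    gcongr
    · refine (hB i x).trans ?_
      gcongr
      · exact le_abs_self (B i)
      · exact rpow_le_rpow_abs (hw x) hx _

lemma tendstoLocallyUniformly_coeff [TopologicalSpace X] (h : HasLaurentExpansion w e f c)
    (hw : ∀ x, 1 ≤ w x) (hwc : Continuous w) (j : ℤ) :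
    TendstoLocallyUniformly (fun (t : ℝ) x => ((t : ℂ) ^ j)⁻¹ *
      (f x t - ∑ i ∈ Finset.Icc (j + 1) ⌊e⌋, c i x * (t : ℂ) ^ i)) (c j) atTop := by
  refine tendstoLocallyUniformly_of_forall_exists_nhds fun x => ⟨{x' | w x' ≤ w x + 1},
    (hwc.tendsto x).eventually_le_const (lt_add_one _), Metric.tendstoUniformlyOn_iff.2 ?_⟩
  intro ε hε
  obtain ⟨C, hC⟩ := h.exists_norm_sub_sum_le hw (w x + 1) j
  have hzero : Tendsto (fun t : ℝ => C * t⁻¹) atTop (𝓝 0) := by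
    simpa using tendsto_inv_atTop_zero.const_mul C
  filter_upwards [hzero.eventually_lt_const hε, eventually_ge_atTop (w x + 1)] with t htε ht x' hx'
  have htpos : 0 < t := by linarith [hw x]
  have htC : (t : ℂ) ^ j ≠ 0 := zpow_ne_zero _ (by exact_mod_cast htpos.ne')
  have hsum : ∑ i ∈ Finset.Icc j ⌊e⌋, c i x' * (t : ℂ) ^ i =
      c j x' * (t : ℂ) ^ j + ∑ i ∈ Finset.Icc (j + 1) ⌊e⌋, c i x' * (t : ℂ) ^ i := by
    rcases le_or_gt j ⌊e⌋ with hj | hj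
    · rw [← Finset.insert_Icc_add_one_left_eq_Icc hj, Finset.sum_insert (by simp)]
    · rw [h.coeff_eq_zero j (Int.floor_lt.1 hj), Finset.Icc_eq_empty (by omega),
        Finset.Icc_eq_empty (by omega)]
      simp
  rw [dist_comm, dist_eq_norm]
  refine lt_of_le_of_lt ?_ htε
  calc ‖((t : ℂ) ^ j)⁻¹ * (f x' t - ∑ i ∈ Finset.Icc (j + 1) ⌊e⌋, c i x' * (t : ℂ) ^ i) - c j x'‖
      = (t ^ j)⁻¹ * ‖f x' t - ∑ i ∈ Finset.Icc j ⌊e⌋, c i x' * (t : ℂ) ^ i‖ := by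
        rw [hsum, ← Real.norm_of_nonneg (zpow_pos htpos j).le, ← Complex.norm_real,
          Complex.ofReal_zpow, ← norm_inv, ← norm_mul]
        congr 1
        field_simp
        ring
    _ ≤ (t ^ j)⁻¹ * (C * t ^ (j - 1)) := by
        gcongr
        exact hC x' t hx' ht
    _ = C * t⁻¹ := by
        rw [zpow_sub_one₀ htpos.ne']
        field_simp

end HasLaurentExpansion

end LaurentRemainderBounds

section Regularity

open Filter Topology

lemma tendstoLocallyUniformly_pi {X ι κ : Type*} [TopologicalSpace X] {E : κ → Type*}
    [∀ i, UniformSpace (E i)] {F : ι → X → ∀ i, E i} {f : X → ∀ i, E i} {l : Filter ι}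
    (h : ∀ i, TendstoLocallyUniformly (fun n x => F n x i) (f · i) l) :
    TendstoLocallyUniformly F f l := by
  simp only [tendstoLocallyUniformly_iff_forall_tendsto, Pi.uniformity, tendsto_iInf,
    tendsto_comap_iff] at h ⊢
  exact fun x i => h i x

variable {k : ℕ} {d : ℝ} {p : Euc (k + 1) × Euc (k + 1) → ℂ}

/-- The families `F α β` of functions on `ℝᵏ × ℝᵏ` for which the tangential operators `D_{xᵢ}` and
`D_{ξᵢ}`, `i ≤ k`, act by increasing the `i`-th entry of `β` and of `α`, as they do on
`D_ξ^α D_x^β p`. -/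
noncomputable def shiftFamilies (k : ℕ) :
    Submodule ℂ ((Fin (k + 1) → ℕ) → (Fin (k + 1) → ℕ) → Euc k × Euc k → ℂ) where
  carrier := {F | ∀ α β y, HasFDerivAt (F α β)
    (Complex.I • gradCLM (fun i => F α (β + Pi.single i.castSucc 1) y,
      fun i => F (α + Pi.single i.castSucc 1) β y)) y}
  zero_mem' α β y := (hasFDerivAt_const (0 : ℂ) y).congr_fderiv <| by
    change 0 = Complex.I • gradCLM 0
    rw [map_zero]
    exact (smul_zero (A := Euc k × Euc k →L[ℝ] ℂ) Complex.I).symm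
  add_mem' {F G} hF hG α β y := ((hF α β y).add (hG α β y)).congr_fderiv <| by
    rw [← smul_add, ← map_add]
    rfl
  smul_mem' c F hF α β y := ((hF α β y).const_smul c).congr_fderiv <| by
    rw [smul_comm, ← map_smul]
    rfl

lemma mem_shiftFamilies_of_tendstoLocallyUniformly {ι : Type*} {l : Filter ι} [l.NeBot]
    {G : ι → (Fin (k + 1) → ℕ) → (Fin (k + 1) → ℕ) → Euc k × Euc k → ℂ}
    {F : (Fin (k + 1) → ℕ) → (Fin (k + 1) → ℕ) → Euc k × Euc k → ℂ}
    (hG : ∀ n, G n ∈ shiftFamilies k)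
    (h : ∀ α β, TendstoLocallyUniformly (fun n => G n α β) (F α β) l) : F ∈ shiftFamilies k := by
  intro α β y
  have huniform : UniformContinuous fun g : (Fin k → ℂ) × (Fin k → ℂ) => Complex.I • gradCLM g :=
    uniformContinuous_addMonoidHom_of_continuous
      (f := (Complex.I • gradCLM : (Fin k → ℂ) × (Fin k → ℂ) →ₗ[ℂ] _).toAddMonoidHom)
      (LinearMap.continuous_of_finiteDimensional
        ((Complex.I • gradCLM : (Fin k → ℂ) × (Fin k → ℂ) →ₗ[ℂ] _).restrictScalars ℝ))
  have hderiv := huniform.comp_tendstoLocallyUniformly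
    ((tendstoLocallyUniformly_pi fun i => h α (β + Pi.single i.castSucc 1)).prodMk
      (tendstoLocallyUniformly_pi fun i => h (α + Pi.single i.castSucc 1) β))
  exact hasFDerivAt_of_tendstoLocallyUniformlyOn isOpen_univ
    (tendstoLocallyUniformlyOn_univ.2 hderiv) (fun n y _ => hG n α β y)
    (fun y _ => (tendstoLocallyUniformlyOn_univ.2 (h α β)).tendsto_at (Set.mem_univ y))
    (Set.mem_univ y)

/- The coefficient of `t ^ j` is the locally uniform limit, as `t → ∞`, of `t ^ (-j)` times the
slice minus the terms of higher order, and the latter already belong to `shiftFamilies k`. -/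
lemma coeff_mem_shiftFamilies (hp : ContDiff ℝ ∞ p)
    {c : (Fin (k + 1) → ℕ) → (Fin (k + 1) → ℕ) → ℤ → Euc k × Euc k → ℂ}
    (h : ∀ α β, HasLaurentExpansion (fun y : Euc k × Euc k => japBracket y.2)
      (d - multiLength α) (fun y => normalSlice p α β y.1 y.2) (c α β)) (j : ℤ) :
    (fun α β => c α β j) ∈ shiftFamilies k := by
  induction hn : (⌊d⌋ + 1 - j).toNat using Nat.strong_induction_on generalizing j with
  | _ n ih =>
    have hhigher (i : ℤ) (hi : i ∈ Finset.Icc (j + 1) ⌊d⌋) :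
        (fun α β => c α β i) ∈ shiftFamilies k := by
      have := Finset.mem_Icc.1 hi
      exact ih _ (by omega) i rfl
    have hslice (t : ℝ) : (fun α β y => normalSlice p α β y.1 y.2 t) ∈ shiftFamilies k :=
      fun α β y => hasFDerivAt_normalSlice hp α β t y
    refine mem_shiftFamilies_of_tendstoLocallyUniformly (l := atTop) (fun t : ℝ =>
      Submodule.smul_mem _ ((t : ℂ) ^ j)⁻¹ (Submodule.sub_mem _ (hslice t)
        (Submodule.sum_mem _ fun i hi => Submodule.smul_mem _ ((t : ℂ) ^ i) (hhigher i hi))))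
      fun α β => ?_
    have hbracket : Continuous fun y : Euc k × Euc k => japBracket y.2 := by
      unfold japBracket
      fun_prop
    refine ((h α β).tendstoLocallyUniformly_coeff (fun y => one_le_japBracket y.2) hbracket
      j).congr fun t y => ?_
    have hd (i : ℤ) (hi : d < i) : c α β i y * (t : ℂ) ^ i = 0 := by
      rw [(h α β).coeff_eq_zero i (by linarith [(multiLength α).cast_nonneg (α := ℝ)]), zero_mul]
    rw [← sum_Icc_floor_eq hd fun i hi => by rw [(h α β).coeff_eq_zero i hi, zero_mul]]
    simp [mul_comm]

/-- The multi-index `(γ, 0)`. -/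
def extendMulti (γ : Fin k → ℕ) : Fin (k + 1) → ℕ := Fin.snoc (α := fun _ => ℕ) γ 0

lemma extendMulti_add_single (γ : Fin k → ℕ) (i : Fin k) :
    extendMulti (γ + Pi.single i 1) = extendMulti γ + Pi.single i.castSucc 1 := by
  funext l
  refine Fin.lastCases ?_ (fun l => ?_) l
  · simp [extendMulti, (Fin.castSucc_ne_last i).symm]
  · simp [extendMulti, Pi.single_apply]

lemma extendMulti_zero : extendMulti (0 : Fin k → ℕ) = 0 := by
  funext l
  refine Fin.lastCases ?_ (fun l => ?_) l <;> simp [extendMulti]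

lemma multiLength_extendMulti (γ : Fin k → ℕ) : multiLength (extendMulti γ) = multiLength γ := by
  simp [multiLength, extendMulti, Fin.sum_univ_castSucc]

section ShiftFamilies

variable {F : (Fin (k + 1) → ℕ) → (Fin (k + 1) → ℕ) → Euc k × Euc k → ℂ}

lemma contDiff_of_mem_shiftFamilies (hF : F ∈ shiftFamilies k) (α β : Fin (k + 1) → ℕ) :
    ContDiff ℝ ∞ (F α β) := by
  refine contDiff_infty.2 fun n => ?_
  induction n generalizing α β with
  | zero => exact contDiff_zero.2 (continuous_iff_continuousAt.2 fun y => (hF α β y).continuousAt)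
  | succ n ih =>
    have hgrad : ContDiff ℝ n (gradCLM : (Fin k → ℂ) × (Fin k → ℂ) →ₗ[ℂ] _) :=
      (gradCLM.restrictScalars ℝ).toContinuousLinearMap.contDiff
    exact contDiff_succ_iff_hasFDerivAt.2 ⟨_, (hgrad.comp ((contDiff_pi.2 fun i => ih _ _).prodMk
      (contDiff_pi.2 fun i => ih _ _))).const_smul _, hF α β⟩

lemma Dxi_of_mem_shiftFamilies (hF : F ∈ shiftFamilies k) (α β : Fin (k + 1) → ℕ) (γ : Fin k → ℕ) :
    Dxi γ (F α β) = F (α + extendMulti γ) β := by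
  have h := multiD_eq_of_shift (e := fun i => ((0 : Euc k), EuclideanSpace.single i (1 : ℝ)))
    (F := fun γ => F (α + extendMulti γ) β) (fun γ i => funext fun y => by
      rw [dirDeriv, (hF _ _ y).fderiv, _root_.smul_apply, gradCLM_apply]
      simp [extendMulti_add_single, add_assoc]) 0 γ
  rw [zero_add, extendMulti_zero, add_zero] at h
  exact h

lemma Dx_of_mem_shiftFamilies (hF : F ∈ shiftFamilies k) (α β : Fin (k + 1) → ℕ) (γ : Fin k → ℕ) :
    Dx γ (F α β) = F α (β + extendMulti γ) := by
  have h := multiD_eq_of_shift (e := fun i => (EuclideanSpace.single i (1 : ℝ), (0 : Euc k)))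
    (F := fun γ => F α (β + extendMulti γ)) (fun γ i => funext fun y => by
      rw [dirDeriv, (hF _ _ y).fderiv, _root_.smul_apply, gradCLM_apply]
      simp [extendMulti_add_single, add_assoc]) 0 γ
  rw [zero_add, extendMulti_zero, add_zero] at h
  exact h

lemma isSymbol_of_mem_shiftFamilies {r : ℝ} (hF : F ∈ shiftFamilies k)
    (hbound : ∀ α β, ∃ C : ℝ, ∀ y, ‖F α β y‖ ≤ C * japBracket y.2 ^ (r - multiLength α))
    (α β : Fin (k + 1) → ℕ) : IsSymbol (r - multiLength α) (F α β) := by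
  refine ⟨contDiff_of_mem_shiftFamilies hF α β, fun γ δ => ?_⟩
  obtain ⟨C, hC⟩ := hbound (α + extendMulti γ) (β + extendMulti δ)
  refine ⟨C, fun x ξ => (japBracket_rpow_neg_mul_le_iff ξ).2 ?_⟩
  rw [Dxi_of_mem_shiftFamilies hF, Dx_of_mem_shiftFamilies hF, sub_sub, ← Nat.cast_add,
    ← multiLength_extendMulti γ, ← multiLength_add]
  exact hC (x, ξ)

end ShiftFamilies

end Regularity

section NormalExpansion

variable {k : ℕ} {d : ℝ} {p : Euc (k + 1) × Euc (k + 1) → ℂ} {α β : Fin (k + 1) → ℕ}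

lemma IsSymbol.exists_norm_normalSlice_le_of_abs_le (hp : IsSymbol d p) (α β : Fin (k + 1) → ℕ) :
    ∃ C : ℝ, ∀ (y : Euc k × Euc k) (t : ℝ), |t| ≤ japBracket y.2 →
      ‖normalSlice p α β y.1 y.2 t‖ ≤ C * japBracket y.2 ^ (d - multiLength α) := by
  obtain ⟨C, hC0, hC⟩ := hp.norm_normalSlice_le α β
  refine ⟨C * 2 ^ |d - multiLength α|, fun ⟨x, ξ⟩ t ht => (hC x ξ t).trans ?_⟩
  have hle := japBracket_le_japBracket_joinLast ξ t
  rw [mul_assoc]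
  exact mul_le_mul_of_nonneg_left (rpow_le_of_comparable (japBracket_pos _) (japBracket_pos ξ)
    (by linarith [japBracket_joinLast_le ξ t]) (by linarith [japBracket_pos ξ]) _) hC0

lemma IsSymbol.exists_norm_laurentRemainder_normalSlice_le (hp : IsSymbol d p)
    {c : ℤ → Euc k × Euc k → ℂ}
    (h : HasLaurentExpansion (fun y : Euc k × Euc k => japBracket y.2) (d - multiLength α)
      (fun y => normalSlice p α β y.1 y.2) c) (m : ℕ) :
    ∃ C : ℝ, ∀ (x ξ : Euc k) (t : ℝ),
      ‖laurentRemainder ⌊d - multiLength α⌋ (normalSlice p α β x ξ) (c · (x, ξ)) m t‖ ≤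
        C * japBracket ξ ^ (d + 1 - multiLength α + m) * (japBracket (joinLast ξ t))⁻¹ := by
  obtain ⟨C, hC⟩ := h.exists_norm_laurentRemainder_le (fun y => japBracket_pos y.2)
    (hp.exists_norm_normalSlice_le_of_abs_le α β) m
  refine ⟨|C|, fun x ξ t => (hC (x, ξ) t).trans ?_⟩
  have := japBracket_pos ξ
  rw [sub_add_eq_add_sub]
  gcongr
  · exact le_abs_self C
  · exact japBracket_pos _
  · exact japBracket_joinLast_le ξ t

theorem IsSymbolUTTR.exists_polynomial_expansion (hp : IsSymbolUTTR d p)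
    (α β : Fin (k + 1) → ℕ) :
    ∃ s : ℤ → Euc k × Euc k → ℂ, IsNormalExpansion d p α β s ∧
      ∀ j : ℤ, (j : ℝ) ≤ d - multiLength α → ∀ x : Euc k,
        IsPolynomialOfDegreeLE (d - j - multiLength α) (fun ξ => s j (x, ξ)) := by
  choose c hc using fun β γ => hp.exists_hasLaurentExpansion_zero γ β
  have hexp := fun α β => hp.1.hasLaurentExpansion_expansionCoeff (hc β) α
  refine ⟨expansionCoeff d (c β) α, ⟨fun j _ => ?_,
    hp.1.exists_norm_laurentRemainder_normalSlice_le (hexp α β)⟩,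
    fun j hj x => expansionCoeff_polynomial α hj x⟩
  refine isSymbol_of_mem_shiftFamilies (coeff_mem_shiftFamilies hp.1.1 hexp j) (fun α β => ?_) α β
  rw [sub_right_comm]
  exact (hexp α β).coeff_bound j

namespace IsNormalExpansion

variable {s s' : ℤ → Euc k × Euc k → ℂ}

lemma exists_norm_sub_sum_le (hs : IsNormalExpansion d p α β s) (x ξ : Euc k) (m : ℕ) :
    ∃ C : ℝ, ∀ t : ℝ, 1 ≤ t → ‖normalSlice p α β x ξ t -
      ∑ j ∈ Finset.Icc (-(m : ℤ)) ⌊d - multiLength α⌋, s j (x, ξ) * (t : ℂ) ^ j‖ ≤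
        C * t ^ (-(m : ℝ) - 1) := by
  obtain ⟨C, hC⟩ := hs.2 m
  set A := japBracket ξ ^ (d + 1 - multiLength α + m)
  have hA : 0 < A := Real.rpow_pos_of_pos (japBracket_pos ξ) _
  refine ⟨|C| * A, fun t ht => ?_⟩
  have htpos : 0 < t := one_pos.trans_le ht
  have hrem := hC x ξ t
  change ‖laurentRemainder _ _ (s · (x, ξ)) m t‖ ≤ _ at hrem
  rw [laurentRemainder_eq_mul _ _ _ _ htpos.ne', norm_mul, norm_pow, Complex.norm_real,
    Real.norm_of_nonneg htpos.le, ← le_div_iff₀' (by positivity)] at hrem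
  have hbracket : (japBracket (joinLast ξ t))⁻¹ ≤ t⁻¹ :=
    inv_anti₀ htpos ((le_abs_self t).trans (abs_le_japBracket_joinLast ξ t))
  calc
    _ ≤ C * A * (japBracket (joinLast ξ t))⁻¹ / t ^ m := hrem
    _ ≤ |C| * A * t⁻¹ / t ^ m := by
      gcongr
      · exact inv_nonneg.2 (japBracket_pos _).le
      · exact le_abs_self C
    _ = |C| * A * t ^ (-(m : ℝ) - 1) := by
      rw [Real.rpow_sub_one htpos.ne', Real.rpow_neg htpos.le, Real.rpow_natCast]
      ring

theorem unique (hs : IsNormalExpansion d p α β s) (hs' : IsNormalExpansion d p α β s') {j : ℤ}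
    (hj : (j : ℝ) ≤ d - multiLength α) : s' j = s j := by
  funext ⟨x, ξ⟩
  obtain ⟨C, hC⟩ := hs.exists_norm_sub_sum_le x ξ j.natAbs
  obtain ⟨C', hC'⟩ := hs'.exists_norm_sub_sum_le x ξ j.natAbs
  refine sub_eq_zero.1 (coeff_eq_zero_of_growth (a := -(j.natAbs : ℤ)) (b := ⌊d - multiLength α⌋)
    (c := fun j => s' j (x, ξ) - s j (x, ξ)) (C := C + C') (r := -(j.natAbs : ℝ) - 1)
    (fun t ht => ?_) j (Finset.mem_Icc.2 ⟨by omega, Int.le_floor.2 hj⟩) ?_)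
  · simp only [sub_mul, Finset.sum_sub_distrib]
    rw [← sub_sub_sub_cancel_left _ _ (normalSlice p α β x ξ t), add_mul]
    exact norm_sub_le_of_le (hC t ht) (hC' t ht)
  · exact_mod_cast (by omega : -(j.natAbs : ℤ) - 1 < j)

end IsNormalExpansion

end NormalExpansion

theorem proposition3p1 {k : ℕ} (d : ℝ) (p : Euc (k + 1) × Euc (k + 1) → ℂ)
    (hp : IsSymbol d p) :
    [IsSymbolUTTR d p,
      ∀ α β : Fin (k + 1) → ℕ, ∃ s : ℤ → Euc k × Euc k → ℂ, IsNormalExpansion d p α β s,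
      HasWeightedKernelBounds d p].TFAE ∧
    (IsSymbolUTTR d p →
      ∀ (α β : Fin (k + 1) → ℕ) (s : ℤ → Euc k × Euc k → ℂ), IsNormalExpansion d p α β s →
        (∀ s' : ℤ → Euc k × Euc k → ℂ, IsNormalExpansion d p α β s' →
          ∀ j : ℤ, (j : ℝ) ≤ d - multiLength α → s' j = s j) ∧
        ∀ j : ℤ, (j : ℝ) ≤ d - multiLength α → ∀ x' : Euc k,
          IsPolynomialOfDegreeLE (d - j - multiLength α) (fun ξ' => s j (x', ξ'))) := by
  constructor
  · tfae_have 1 → 2 := fun h α β => by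
      obtain ⟨s, hs, -⟩ := h.exists_polynomial_expansion α β
      exact ⟨s, hs⟩
    tfae_have 2 → 3 := hasWeightedKernelBounds_of_expansion hp
    tfae_have 3 → 1 := fun h => h.isSymbolUTTR hp
    tfae_finish
  · intro h α β s hs
    obtain ⟨s₀, hs₀, hpoly⟩ := h.exists_polynomial_expansion α β
    refine ⟨fun s' hs' j hj => hs.unique hs' hj, fun j hj x => ?_⟩
    rw [hs₀.unique hs hj]
    exact hpoly j hj x
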